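/- Let $G=(V,E)$ be a finite connected directed graph (loops and multiple edges allowed), let $r=|E|-|V|+1$, and let $T\subseteq E$ be the edge set of a spanning forest of $G$ (a maximal cycle-free spanning subgraph). Let $C$ be the matrix with rows indexed by $T$ and columns indexed by $E\setminus T$ such that the column of $e\in E\setminus T$ is the sign vector of the unique path in $T$ from the head of $e$ to the tail of $e$ (entry $+1$, resp. $-1$, at the edges that this path traverses along, resp. against, their orientation, and $0$ at all other edges of $T$). The flow polytope of $G$ is $$F_G=\{f\in\mathbb R^{E\setminus T} : -1\le -Cf\le 1,\ -1\le f\le 1\},$$ the inequalities being coordinatewise. For a polynomial $p$ of degree $d$ let $h_i^*(p)$, $i\ge 0$, be defined by $(1-z)^{d+1}\sum_{k\ge 0}p(k)z^k=\sum_{i\ge 0} h_i^*(p)z^i$ (so $h^*_i(p)=0$ for $i>d$). Put $B(n,i)=\sum_{j=1}^{i}(-1)^{i-j}\binom{n}{i-j}(2j-1)^{n-1}$ for $n\ge 1$, $i\ge 0$. Then there is a polynomial $L$ of degree $r$ with $L(k)=|\mathbb Z^{E\setminus T}\cap kF_G|$ for all integers $k\ge 1$, and $h_i^*(F_G):=h_i^*(L)$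 satisfies $$\binom{r}{i}\le h_i^*(F_G)\le h_i^*\big((2k+1)^r\big)=B(r+1,i+1)$$ for all $i\ge 0$ (for $i>r$ all these numbers are $0$). The upper bound is tight for every $r\ge 0$: if $G$ is the graph consisting of a single vertex and $r$ loops (so that $T=\emptyset$), then $h_i^*(F_G)=B(r+1,i+1)$ for all $i$. -/

import Mathlib

open Polynomial Matrix
open scoped Pointwise

universe u v

/-- A directed graph with vertex set `V` and edge set `E`; multiple edges and loops are allowed. -/
structure DirMultigraph (V E : Type*) where
  /-- the tail (initial vertex) of an edge -/
  tail : E → V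
  /-- the head (terminal vertex) of an edge -/
  head : E → V

namespace DirMultigraph

/-- A step `(e, true)` traverses `e` along its orientation, `(e, false)` against it.
`src` is the vertex where the step starts. -/
def src {V E : Type*} (G : DirMultigraph V E) (s : E × Bool) : V :=
  if s.2 then G.tail s.1 else G.head s.1

/-- The vertex where a step ends. -/
def tgt {V E : Type*} (G : DirMultigraph V E) (s : E × Bool) : V :=
  if s.2 then G.head s.1 else G.tail s.1

/-- `G.IsWalk u v l`: the list of steps `l` is a walk from `u` to `v` in the underlying
undirected graph of `G`. -/
def IsWalk {V E : Type*} (G : DirMultigraph V E) : V → V → List (E × Bool) → Prop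
  | u, v, [] => u = v
  | u, v, s :: l => G.src s = u ∧ G.IsWalk (G.tgt s) v l

/-- `l` is a path (no repeated vertex) from `u` to `v` using only edges of `T`. -/
def IsPathIn {V E : Type*} (G : DirMultigraph V E) (T : Finset E) (u v : V)
    (l : List (E × Bool)) : Prop :=
  G.IsWalk u v l ∧ (∀ s ∈ l, s.1 ∈ T) ∧ (u :: l.map G.tgt).Nodup

/-- `l` is a cycle through `u` in the underlying undirected graph using only edges of `T`: a closed
walk of positive length with no repeated vertex and no repeated edge. A loop is a cycle of
length one, and two parallel edges form a cycle of length two. -/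
def IsCycleIn {V E : Type*} (G : DirMultigraph V E) (T : Finset E) (u : V)
    (l : List (E × Bool)) : Prop :=
  l ≠ [] ∧ G.IsWalk u u l ∧ (∀ s ∈ l, s.1 ∈ T) ∧ (l.map G.tgt).Nodup ∧ (l.map Prod.fst).Nodup

/-- The spanning subgraph with edge set `T` has no cycle. -/
def CycleFree {V E : Type*} (G : DirMultigraph V E) (T : Finset E) : Prop :=
  ∀ u l, ¬ G.IsCycleIn T u l

/-- `T` is the edge set of a spanning forest: a maximal cycle-free spanning subgraph. -/
def IsSpanningForest {V E : Type*} (G : DirMultigraph V E) (T : Finset E) : Prop :=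
  Maximal G.CycleFree T

/-- The underlying undirected graph is connected (and has a vertex). -/
def Connected {V E : Type*} (G : DirMultigraph V E) : Prop :=
  Nonempty V ∧ ∀ u v, ∃ l, G.IsWalk u v l

open Classical in
/-- The matrix `C`, with a row for every edge of `T` and a column for every edge outside `T`.
For a spanning forest `T` and `e ∉ T` there is exactly one path in `T` from the head of `e` to the
tail of `e`, and the column of `e` is the sign vector of this path: the entry at `t ∈ T` is `1` if
the path traverses `t` along its orientation, `-1` if it traverses `t` against it, and `0` if `t`
is not on the path. -/
noncomputable def forestMatrix {V E : Type*} (G : DirMultigraph V E) (T : Finset E) :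
    Matrix {e // e ∈ T} {e // e ∉ T} ℝ := fun t e =>
  if ∃ l, G.IsPathIn T (G.head e) (G.tail e) l ∧ ((t : E), true) ∈ l then 1
  else if ∃ l, G.IsPathIn T (G.head e) (G.tail e) l ∧ ((t : E), false) ∈ l then -1
  else 0

/-- The flow polytope `{f ∈ ℝ^(E \ T) | -1 ≤ -C f ≤ 1, -1 ≤ f ≤ 1}` of `G` with respect to the
spanning forest `T`. -/
def flowPolytope {V E : Type*} [Fintype E] [DecidableEq E] (G : DirMultigraph V E)
    (T : Finset E) : Set ({e // e ∉ T} → ℝ) :=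
  {f | (∀ t, -1 ≤ -(G.forestMatrix T *ᵥ f) t ∧ -(G.forestMatrix T *ᵥ f) t ≤ 1) ∧
    ∀ e, -1 ≤ f e ∧ f e ≤ 1}

/-- The graph with a single vertex and `r` loops. -/
def bouquet (r : ℕ) : DirMultigraph Unit (Fin r) where
  tail _ := ()
  head _ := ()

end DirMultigraph

/-- The Ehrhart function `k ↦ |ℤ^ι ∩ k • A|`. -/
noncomputable def ehrhart {ι : Type*} (A : Set (ι → ℝ)) (k : ℕ) : ℕ :=
  {z : ι → ℤ | (fun i => (z i : ℝ)) ∈ (k : ℝ) • A}.ncard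

/-- `L` is the Ehrhart polynomial of `A`: it agrees with the Ehrhart function at every positive
integer (there is at most one such polynomial). -/
def IsEhrhartPolynomial {ι : Type*} (L : ℚ[X]) (A : Set (ι → ℝ)) : Prop :=
  ∀ k : ℕ, 0 < k → L.eval (k : ℚ) = (ehrhart A k : ℚ)

/-- The entry `h*_i` of the `h*`-vector of a polynomial `p` of degree `d`: the coefficient of `z^i`
in `(1 - z)^(d + 1) * ∑_{k ≥ 0} p(k) z^k` (it vanishes for `i > d`). -/
noncomputable def hStar (p : ℚ[X]) (i : ℕ) : ℚ :=
  PowerSeries.coeff i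
    ((1 - PowerSeries.X) ^ (p.natDegree + 1) * PowerSeries.mk fun k : ℕ => p.eval (k : ℚ))

/-- The MacMahon number `B(n, i) = ∑_{j=1}^i (-1)^(i-j) (n choose (i-j)) (2j-1)^(n-1)`, for
`n ≥ 1`. -/
def macMahon (n i : ℕ) : ℤ :=
  ∑ j ∈ Finset.Icc 1 i, (-1) ^ (i - j) * (n.choose (i - j) : ℤ) * (2 * (j : ℤ) - 1) ^ (n - 1)

/-!
Let `A` be the integral matrix whose rows are the coordinate forms of the flow space, in the
coordinates `f e`, `e ∉ T`: the rows of `e ∉ T` are unit vectors, the others form the matrix of the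
forest. Then `F = {x | |A e x| ≤ 1 for all e}` lies in the cube `Q = {x | |x e| ≤ 1}`, and the only
property of the graph that matters is that a real flow can be rounded to an integral flow
(`exists_rounded_flow`). Because of it, every cell `{x | a e ≤ A e x ≤ a e + 1}` of the arrangement
of hyperplanes `A e x ∈ ℤ` is a lattice polytope of width one in each of these directions. No
triangulation is needed: the lattice points of the cones over the cells are decomposed directly.

Fix a direction `v` whose coordinates are linearly independent over `ℤ`. The half-open cone over a
cell consists of the lattice points `x` such that `x + ε v` is in the cone for all small `ε > 0`.
If `p` is a lattice point of height one in the cone, each defining form has value `0` or `1` at `p`,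
so the half-open cone is the disjoint union of sets of rays `x + ℕ p`, where `x` runs through
a half-open facet that does not contain `p`; the rays start at `x + p` instead of `x` if `v` is
on the negative side of the facet (`exists_hasSeries_peel`). By induction on the dimension, the
generating function of a half-open cone is `h(t) / (1 - t) ^ (r + 1)`, where `h` has nonnegative coefficients
and degree at most `r` (`exists_numerator`).

If `v` is in the interior of the cone over `F`, then the cones over `F` and `Q` are the disjoint
unions of the half-open cones over the cells they contain (`slabCone_eq_iUnion`). As `F ⊆ Q`, the
sum of the numerators for `F` is at most the one for `Q`: this is the upper bound.

For the lower bound, take for each sign vector a cell at the origin in its orthant that meets each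
space spanned by the first `m` coordinates in dimension `m` (`exists_flag_cell`). If the coordinates
of `v` are positive and decrease fast, the facets on the coordinate hyperplanes, peeled off from the last
coordinate to the first, show that the numerator of this cell contains `t ^ s`, where `s` is the
number of negative signs (`exists_numerator_flag`). There are `r.choose s` such sign vectors.
-/

/-! ### Generating functions of graded sets of lattice points -/

namespace LatticeCone

/-- `HasSeries δ S f`: the set `S` of lattice points has finitely many elements `x` in each
degree `δ ⬝ᵥ x = k`, and `f` is the generating function of their numbers. Points of negative degree
are not counted. -/
def HasSeries {ι : Type*} [Fintype ι] (δ : ι → ℤ) (S : Set (ι → ℤ)) (f : PowerSeries ℕ) : Prop :=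
  ∀ k : ℕ, {x ∈ S | δ ⬝ᵥ x = (k : ℤ)}.Finite ∧
    {x ∈ S | δ ⬝ᵥ x = (k : ℤ)}.ncard = PowerSeries.coeff k f

section Series

variable {ι : Type*} [Fintype ι] {δ : ι → ℤ}

theorem HasSeries.unique {S : Set (ι → ℤ)} {f g : PowerSeries ℕ} (hf : HasSeries δ S f)
    (hg : HasSeries δ S g) : f = g := by
  ext k
  rw [← (hf k).2, ← (hg k).2]

theorem HasSeries.biUnion {κ : Type*} (s : Finset κ) {S : κ → Set (ι → ℤ)}
    {f : κ → PowerSeries ℕ} (h : ∀ a ∈ s, HasSeries δ (S a) (f a))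
    (hd : (s : Set κ).PairwiseDisjoint S) :
    HasSeries δ (⋃ a ∈ s, S a) (∑ a ∈ s, f a) := by
  intro k
  have e : {x ∈ ⋃ a ∈ s, S a | δ ⬝ᵥ x = (k : ℤ)} =
      ⋃ a ∈ (s : Set κ), {x ∈ S a | δ ⬝ᵥ x = (k : ℤ)} := by
    ext x; simp only [Set.mem_ofPred_eq, Set.mem_iUnion, Finset.mem_coe]; tauto
  rw [e]
  constructor
  · exact Set.Finite.biUnion s.finite_toSet fun a ha => (h a ha k).1
  · rw [Set.Finite.ncard_biUnion s.finite_toSet (fun a ha => (h a ha k).1)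
      (hd.mono fun a x hx => hx.1), finsum_mem_coe_finset, map_sum]
    exact Finset.sum_congr rfl fun a ha => (h a ha k).2

theorem HasSeries.translate {S : Set (ι → ℤ)} {f : PowerSeries ℕ} (h : HasSeries δ S f)
    (hS : ∀ x ∈ S, 0 ≤ δ ⬝ᵥ x) {p : ι → ℤ} (hp : δ ⬝ᵥ p = 1) :
    HasSeries δ {x | x - p ∈ S} (PowerSeries.X * f) := by
  intro k
  rcases k with _ | k
  · have e : {x ∈ {x | x - p ∈ S} | δ ⬝ᵥ x = ((0 : ℕ) : ℤ)} = ∅ := by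
      ext x
      simp only [Set.mem_ofPred_eq, Set.mem_empty_iff_false, iff_false, not_and]
      intro hx h0
      have := hS _ hx
      rw [dotProduct_sub, hp, h0] at this
      simp at this
    rw [e]; simp
  · have e : {x ∈ {x | x - p ∈ S} | δ ⬝ᵥ x = ((k + 1 : ℕ) : ℤ)} =
        (fun x => x + p) '' {x ∈ S | δ ⬝ᵥ x = (k : ℤ)} := by
      ext x
      simp only [Set.mem_ofPred_eq, Set.mem_image]
      constructor
      · rintro ⟨h1, h2⟩
        refine ⟨x - p, ⟨h1, ?_⟩, by simp⟩
        rw [dotProduct_sub, hp, h2]; push_cast; ring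
      · rintro ⟨y, ⟨h1, h2⟩, rfl⟩
        refine ⟨by simpa using h1, ?_⟩
        rw [dotProduct_add, hp, h2]; push_cast; ring
    rw [e]
    refine ⟨(h k).1.image _, ?_⟩
    rw [Set.ncard_image_of_injective _ (add_left_injective p), (h k).2,
      PowerSeries.coeff_succ_X_mul]

/-- If `S` lies in the hyperplane `ψ = 0` and `p` is a point of degree one with `ψ p = 1`, then
the union of the rays `x + ℕ p`, `x ∈ S`, has the generating function of `S` multiplied by
`1 / (1 - t)`. -/
theorem HasSeries.rays {S : Set (ι → ℤ)} {f : PowerSeries ℕ} (h : HasSeries δ S f)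
    (hS : ∀ x ∈ S, 0 ≤ δ ⬝ᵥ x) {p ψ : ι → ℤ} (hp : δ ⬝ᵥ p = 1) (hψp : ψ ⬝ᵥ p = 1)
    (hψ : ∀ x ∈ S, ψ ⬝ᵥ x = 0) :
    HasSeries δ {x | 0 ≤ ψ ⬝ᵥ x ∧ x - (ψ ⬝ᵥ x) • p ∈ S} (f * PowerSeries.mk 1) := by
  set R : Set (ι → ℤ) := {x | 0 ≤ ψ ⬝ᵥ x ∧ x - (ψ ⬝ᵥ x) • p ∈ S} with hR
  have hdeg : ∀ x ∈ R, ψ ⬝ᵥ x ≤ δ ⬝ᵥ x := by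
    rintro x ⟨-, hx⟩
    have := hS _ hx
    rw [dotProduct_sub, dotProduct_smul, hp] at this
    simpa using this
  have hmk : (PowerSeries.mk 1 : PowerSeries ℕ) = 1 + PowerSeries.X * PowerSeries.mk 1 := by
    ext n
    rcases n with _ | n
    · simp
    · simp [PowerSeries.coeff_succ_X_mul, PowerSeries.coeff_one]
  have hf : f * PowerSeries.mk 1 = f + PowerSeries.X * (f * PowerSeries.mk 1) := by
    conv_lhs => rw [hmk]
    ring
  intro k
  induction k with
  | zero =>
    have e : {x ∈ R | δ ⬝ᵥ x = ((0 : ℕ) : ℤ)} = {x ∈ S | δ ⬝ᵥ x = ((0 : ℕ) : ℤ)} := by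
      ext x
      simp only [Set.mem_ofPred_eq]
      constructor
      · rintro ⟨hx, h0⟩
        have h1 := hdeg x hx
        have h2 : ψ ⬝ᵥ x = 0 := le_antisymm (by rw [h0] at h1; exact_mod_cast h1) hx.1
        have h3 := hx.2
        rw [h2] at h3
        exact ⟨by simpa using h3, h0⟩
      · rintro ⟨hx, h0⟩
        exact ⟨⟨(hψ x hx).ge, by simpa [hψ x hx] using hx⟩, h0⟩
    rw [e]
    refine ⟨(h 0).1, ?_⟩
    rw [(h 0).2]; simp
  | succ k ih =>
    have e : {x ∈ R | δ ⬝ᵥ x = ((k + 1 : ℕ) : ℤ)} = {x ∈ S | δ ⬝ᵥ x = ((k + 1 : ℕ) : ℤ)} ∪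
        (fun x => x + p) '' {x ∈ R | δ ⬝ᵥ x = (k : ℤ)} := by
      ext x
      simp only [Set.mem_ofPred_eq, Set.mem_union, Set.mem_image]
      constructor
      · rintro ⟨hx, hk⟩
        rcases hx.1.eq_or_lt with h0 | h0
        · left
          have h3 := hx.2
          rw [← h0] at h3
          exact ⟨by simpa using h3, hk⟩
        · right
          refine ⟨x - p, ⟨⟨?_, ?_⟩, ?_⟩, by simp⟩
          · rw [dotProduct_sub, hψp]; omega
          · rw [dotProduct_sub, hψp]
            convert hx.2 using 1
            module
          · rw [dotProduct_sub, hp, hk]; push_cast; ring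
      · rintro (⟨hx, hk⟩ | ⟨y, ⟨hy, hk⟩, rfl⟩)
        · exact ⟨⟨(hψ x hx).ge, by simpa [hψ x hx] using hx⟩, hk⟩
        · refine ⟨⟨?_, ?_⟩, ?_⟩
          · rw [dotProduct_add, hψp]; have := hy.1; omega
          · rw [dotProduct_add, hψp]
            convert hy.2 using 1
            module
          · rw [dotProduct_add, hp, hk]; push_cast; ring
    rw [e]
    refine ⟨(h _).1.union (ih.1.image _), ?_⟩
    rw [Set.ncard_union_eq _ (h _).1 (ih.1.image _), (h _).2,
      Set.ncard_image_of_injective _ (add_left_injective p), ih.2]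
    · conv_rhs => rw [hf]
      rw [map_add, PowerSeries.coeff_succ_X_mul]
    rw [Set.disjoint_left]
    rintro x ⟨hx, -⟩ ⟨y, ⟨hy, -⟩, rfl⟩
    have := hψ _ hx
    simp only [dotProduct_add, hψp] at this
    have := hy.1
    omega

/-- The same as `HasSeries.rays` for the rays that start at `x + s p` with `s ∈ {0, 1}`. -/
theorem HasSeries.rays_from {S : Set (ι → ℤ)} {f : PowerSeries ℕ} (h : HasSeries δ S f)
    (hS : ∀ x ∈ S, 0 ≤ δ ⬝ᵥ x) {p ψ : ι → ℤ} (hp : δ ⬝ᵥ p = 1) (hψp : ψ ⬝ᵥ p = 1)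
    (hψ : ∀ x ∈ S, ψ ⬝ᵥ x = 0) {s : ℕ} (hs : s ≤ 1) :
    HasSeries δ {x | (s : ℤ) ≤ ψ ⬝ᵥ x ∧ x - (ψ ⬝ᵥ x) • p ∈ S}
      (PowerSeries.X ^ s * f * PowerSeries.mk 1) := by
  have h0 := h.rays hS hp hψp hψ
  interval_cases s
  · simpa using h0
  · have h1 := h0.translate (p := p) ?_ hp
    · rw [pow_one, mul_assoc]
      convert h1 using 1
      ext x
      simp only [Set.mem_ofPred_eq, dotProduct_sub, hψp, Nat.cast_one, sub_nonneg]
      have : x - p - (ψ ⬝ᵥ x - 1) • p = x - (ψ ⬝ᵥ x) • p := by module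
      rw [this]
    · rintro x ⟨hx0, hx⟩
      have := hS _ hx
      rw [dotProduct_sub, dotProduct_smul, hp] at this
      simp at this
      linarith

/-- `h / (1 - t) ^ d` determines the numerator `h`. -/
theorem mul_mk_one_pow_cancel {d : ℕ} {g h : PowerSeries ℕ}
    (e : g * PowerSeries.mk 1 ^ d = h * PowerSeries.mk 1 ^ d) : g = h := by
  have key : ∀ q : PowerSeries ℕ, PowerSeries.map (Nat.castRingHom ℤ) q =
      PowerSeries.map (Nat.castRingHom ℤ) (q * PowerSeries.mk 1 ^ d) *
        (1 - PowerSeries.X) ^ d := by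
    intro q
    have : PowerSeries.map (Nat.castRingHom ℤ) (PowerSeries.mk 1) = PowerSeries.mk 1 := by
      ext; simp
    rw [map_mul, map_pow, this, mul_assoc, ← mul_pow, PowerSeries.mk_one_mul_one_sub_eq_one,
      one_pow, mul_one]
  have := (key g).trans ((congrArg (fun q => PowerSeries.map (Nat.castRingHom ℤ) q *
    (1 - PowerSeries.X) ^ d) e).trans (key h).symm)
  ext n
  have := congrArg (PowerSeries.coeff n) this
  simpa using this

end Series

end LatticeCone

/-! ### Half-open cones and their numerators -/

namespace LatticeCone

variable {ι J : Type*} [Fintype ι]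

/-- The value at the real point `v` of the integral linear form with coefficient vector `ψ`. -/
def realValue (ψ : ι → ℤ) (v : ι → ℝ) : ℝ := ∑ i, (ψ i : ℝ) * v i

theorem realValue_add_smul (ψ χ : ι → ℤ) (a : ℤ) (v : ι → ℝ) :
    realValue (ψ + a • χ) v = realValue ψ v + a * realValue χ v := by
  simp [realValue, add_mul, Finset.sum_add_distrib, Finset.mul_sum, mul_assoc]

theorem realValue_intCast (ψ x : ι → ℤ) : realValue ψ (fun i => (x i : ℝ)) = (ψ ⬝ᵥ x : ℤ) := by
  simp [realValue, dotProduct]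

/-- The lexicographic order on pairs: `a + b ε ≥ 0` for an infinitesimal `ε > 0`. -/
def LexNonneg (a : ℤ) (b : ℝ) : Prop := 0 < a ∨ (a = 0 ∧ 0 ≤ b)

/-- The lattice points of the smallest intersection of hyperplanes `φ j = 0` that contains `v`. In
the applications it is spanned by a face of the cone `{φ j ≥ 0 | j}`. -/
def faceLattice (φ : J → ι → ℤ) (v : ι → ℝ) : Submodule ℤ (ι → ℤ) where
  carrier := {x | ∀ j, realValue (φ j) v = 0 → φ j ⬝ᵥ x = 0}
  add_mem' hx hy j hj := by rw [dotProduct_add, hx j hj, hy j hj, add_zero]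
  zero_mem' j _ := dotProduct_zero _
  smul_mem' c x hx j hj := by rw [dotProduct_smul, hx j hj, smul_zero]

/-- `v` is a generic point of the real span of `faceLattice φ v`: an integral linear form vanishes
at `v` only if it vanishes on the whole lattice. -/
def IsGeneric (φ : J → ι → ℤ) (v : ι → ℝ) : Prop :=
  ∀ ψ : ι → ℤ, realValue ψ v = 0 ↔ ∀ x ∈ faceLattice φ v, ψ ⬝ᵥ x = 0

/-- The lattice points `x` of `faceLattice φ v` such that `x + ε v` lies in the cone
`{φ j ≥ 0 | j}` for all small `ε > 0`. -/
def halfOpen (φ : J → ι → ℤ) (v : ι → ℝ) : Set (ι → ℤ) :=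
  {x | x ∈ faceLattice φ v ∧ ∀ j, LexNonneg (φ j ⬝ᵥ x) (realValue (φ j) v)}

/-- The cone `{φ j ≥ 0 | j}` graded by the linear form `δ` is the cone over a polytope that is a
lattice polytope of width one in the direction of each of its facets, and so are its faces.
In `round`, the point `y` need not be a lattice point; `p` is in the smallest face containing it. -/
structure IsCompressed (φ : J → ι → ℤ) (δ : ι → ℤ) : Prop where
  exists_degree : ∃ j, φ j = δ
  width : ∀ p : ι → ℤ, δ ⬝ᵥ p = 1 → (∀ j, 0 ≤ φ j ⬝ᵥ p) → ∀ j, φ j ⬝ᵥ p ≤ 1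
  round : ∀ y : ι → ℝ, y ≠ 0 → (∀ j, 0 ≤ realValue (φ j) y) →
    ∃ p : ι → ℤ, δ ⬝ᵥ p = 1 ∧ (∀ j, 0 ≤ φ j ⬝ᵥ p) ∧ ∀ j, realValue (φ j) y = 0 → φ j ⬝ᵥ p = 0

/-- The point `v` moved along `p` into the hyperplane where the form `ψ` vanishes
(if `ψ p = 1`). -/
def project (ψ p : ι → ℤ) (v : ι → ℝ) : ι → ℝ := fun i => v i - realValue ψ v * p i

theorem realValue_project (χ ψ p : ι → ℤ) (v : ι → ℝ) :
    realValue χ (project ψ p v) = realValue χ v - realValue ψ v * (χ ⬝ᵥ p : ℤ) := by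
  simp only [realValue, project, mul_sub, Finset.sum_sub_distrib, dotProduct, Int.cast_sum,
    Int.cast_mul, Finset.mul_sum]
  congr 1
  exact Finset.sum_congr rfl fun i _ => by ring

/-- One if `v` lies on the negative side of the facet `ψ = 0`, which is then removed from the
half-open cone, and zero otherwise. It is a lower bound for `ψ` on the half-open cone. -/
noncomputable def visible (ψ : ι → ℤ) (v : ι → ℝ) : ℕ := open Classical in
  if realValue ψ v < 0 then 1 else 0

theorem visible_le_one (ψ : ι → ℤ) (v : ι → ℝ) : visible ψ v ≤ 1 := by
  unfold visible; split_ifs <;> simp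

theorem lexNonneg_iff_visible_le {ψ : ι → ℤ} {v : ι → ℝ} {a : ℤ} :
    LexNonneg a (realValue ψ v) ↔ (visible ψ v : ℤ) ≤ a := by
  unfold LexNonneg visible
  split_ifs with h
  · have := not_le.2 h
    simp only [this, and_false, or_false, Nat.cast_one]; omega
  · have := not_lt.1 h
    simp only [this, and_true, Nat.cast_zero]; omega

section Peel

variable {φ : J → ι → ℤ} {δ : ι → ℤ} {v : ι → ℝ} {p : ι → ℤ} {g : J}

theorem mem_faceLattice_project (hv : IsGeneric φ v) (hp : p ∈ faceLattice φ v)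
    (hg : φ g ⬝ᵥ p = 1) {x : ι → ℤ} :
    x ∈ faceLattice φ (project (φ g) p v) ↔ x ∈ faceLattice φ v ∧ φ g ⬝ᵥ x = 0 := by
  constructor
  · intro hx
    refine ⟨fun j hj => hx j ?_, hx g ?_⟩
    · rw [realValue_project, hj, hp j hj]; simp
    · rw [realValue_project, hg]; simp
  · rintro ⟨hx, hx0⟩ j hj
    rw [realValue_project] at hj
    have h1 : realValue (φ j + (-(φ j ⬝ᵥ p)) • φ g) v = 0 := by
      rw [realValue_add_smul]; push_cast; linarith
    have h2 := (hv _).1 h1 x hx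
    rw [add_dotProduct, smul_dotProduct, hx0] at h2
    simpa using h2

theorem IsGeneric.project (hv : IsGeneric φ v) (hp : p ∈ faceLattice φ v)
    (hg : φ g ⬝ᵥ p = 1) : IsGeneric φ (project (φ g) p v) := by
  intro ψ
  have h1 : realValue ψ (LatticeCone.project (φ g) p v) =
      realValue (ψ + (-(ψ ⬝ᵥ p)) • φ g) v := by
    rw [realValue_project, realValue_add_smul]; push_cast; ring
  rw [h1, hv]
  constructor
  · intro h x hx
    obtain ⟨hx1, hx0⟩ := (mem_faceLattice_project hv hp hg).1 hx
    have h2 := h x hx1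
    rw [add_dotProduct, smul_dotProduct, hx0] at h2
    simpa using h2
  · intro h x hx
    have h2 := h (x - (φ g ⬝ᵥ x) • p) ?_
    · rw [dotProduct_sub, dotProduct_smul] at h2
      rw [add_dotProduct, smul_dotProduct]
      simp only [smul_eq_mul] at h2 ⊢
      linarith
    · rw [mem_faceLattice_project hv hp hg]
      refine ⟨Submodule.sub_mem _ hx (Submodule.smul_mem _ _ hp), ?_⟩
      rw [dotProduct_sub, dotProduct_smul, hg]; simp

theorem finrank_faceLattice_project (hv : IsGeneric φ v) (hp : p ∈ faceLattice φ v)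
    (hg : φ g ⬝ᵥ p = 1) :
    Module.finrank ℤ (faceLattice φ v) =
      Module.finrank ℤ (faceLattice φ (project (φ g) p v)) + 1 := by
  let e : faceLattice φ v ≃ₗ[ℤ] faceLattice φ (LatticeCone.project (φ g) p v) × ℤ :=
    { toFun := fun x => (⟨x.1 - (φ g ⬝ᵥ x.1) • p, (mem_faceLattice_project hv hp hg).2
        ⟨Submodule.sub_mem _ x.2 (Submodule.smul_mem _ _ hp), by
          rw [dotProduct_sub, dotProduct_smul, hg]; simp⟩⟩, φ g ⬝ᵥ x.1)
      invFun := fun y => ⟨y.1.1 + y.2 • p, Submodule.add_mem _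
        ((mem_faceLattice_project hv hp hg).1 y.1.2).1 (Submodule.smul_mem _ _ hp)⟩
      map_add' := fun x y => by
        ext
        · simp [dotProduct_add, add_mul]; ring
        · simp [dotProduct_add]
      map_smul' := fun c x => by
        ext
        · simp [-zsmul_eq_mul, dotProduct_smul]; ring
        · simp [-zsmul_eq_mul, dotProduct_smul]
      left_inv := fun x => by ext; simp
      right_inv := fun y => by
        have := ((mem_faceLattice_project hv hp hg).1 y.1.2).2
        ext
        · simp [-zsmul_eq_mul, dotProduct_add, dotProduct_smul, hg, this]
        · simp [-zsmul_eq_mul, dotProduct_add, dotProduct_smul, hg, this] }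
  rw [e.finrank_eq, Module.finrank_prod, Module.finrank_self]

theorem zero_le_degree (hφ : IsCompressed φ δ) {x : ι → ℤ} (hx : x ∈ halfOpen φ v) :
    0 ≤ δ ⬝ᵥ x := by
  obtain ⟨j, rfl⟩ := hφ.exists_degree
  rcases hx.2 j with h | h
  · exact h.le
  · exact h.1.ge

/-- The part of the half-open cone whose points leave it through the facet `φ g = 0` when they move
in the direction `-p` consists of rays in direction `p` over the half-open facet. -/
theorem halfOpen_slice (hφ : IsCompressed φ δ) (hv : IsGeneric φ v) (hp : p ∈ faceLattice φ v)
    (hδ : δ ⬝ᵥ p = 1) (hp0 : ∀ j, 0 ≤ φ j ⬝ᵥ p) (hg : φ g ⬝ᵥ p = 1) :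
    {x ∈ halfOpen φ v | ∀ j, φ j ⬝ᵥ p = 1 →
        LexNonneg (φ j ⬝ᵥ x - φ g ⬝ᵥ x) (realValue (φ j) v - realValue (φ g) v)} =
      {x | (visible (φ g) v : ℤ) ≤ φ g ⬝ᵥ x ∧
        x - (φ g ⬝ᵥ x) • p ∈ halfOpen φ (project (φ g) p v)} := by
  ext x
  simp only [Set.mem_ofPred_eq, halfOpen, mem_faceLattice_project hv hp hg, realValue_project,
    ← lexNonneg_iff_visible_le, dotProduct_sub, dotProduct_smul, hg, smul_eq_mul, mul_one, sub_self,
    and_true]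
  have hmem : x - (φ g ⬝ᵥ x) • p ∈ faceLattice φ v ↔ x ∈ faceLattice φ v :=
    Submodule.sub_mem_iff_left _ (Submodule.smul_mem _ _ hp)
  rw [hmem]
  have h01 : ∀ j, φ j ⬝ᵥ p = 0 ∨ φ j ⬝ᵥ p = 1 := fun j => by
    have := hp0 j; have := hφ.width p hδ hp0 j; omega
  constructor
  · rintro ⟨⟨h1, h2⟩, h3⟩
    refine ⟨h2 g, h1, fun j => ?_⟩
    rcases h01 j with h | h
    · simpa [h] using h2 j
    · simpa [h] using h3 j h
  · rintro ⟨h1, h2, h3⟩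
    refine ⟨⟨h2, fun j => ?_⟩, fun j hj => ?_⟩
    · have := h3 j
      rcases h01 j with h | h
      · simpa [h] using this
      · simp only [h, mul_one, Int.cast_one] at this
        unfold LexNonneg at this h1 ⊢
        rcases this with h4 | ⟨h4, h5⟩ <;> rcases h1 with h6 | ⟨h6, h7⟩
        · left; omega
        · left; omega
        · left; omega
        · right; exact ⟨by omega, by linarith⟩
    · simpa [hj] using h3 j

/-- Peeling off the rays in direction `p`: the numerator of a half-open cone is the sum of the
numerators of the half-open facets not containing `p`, each multiplied by `t` if it is visible.
Facets given by forms that agree at `v` coincide, so one form of each class is used; the form `g₀`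
can be prescribed. -/
theorem exists_hasSeries_peel [Fintype J] (hφ : IsCompressed φ δ) (hv : IsGeneric φ v)
    (hp : p ∈ faceLattice φ v) (hδ : δ ⬝ᵥ p = 1) (hp0 : ∀ j, 0 ≤ φ j ⬝ᵥ p) (d : ℕ)
    (h : J → PowerSeries ℕ)
    (hh : ∀ g, φ g ⬝ᵥ p = 1 →
      HasSeries δ (halfOpen φ (project (φ g) p v)) (h g * PowerSeries.mk 1 ^ d))
    (g₀ : J) (hg₀ : φ g₀ ⬝ᵥ p = 1) :
    ∃ B : Finset J, g₀ ∈ B ∧ (∀ g ∈ B, φ g ⬝ᵥ p = 1) ∧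
      HasSeries δ (halfOpen φ v)
        ((∑ g ∈ B, PowerSeries.X ^ visible (φ g) v * h g) * PowerSeries.mk 1 ^ (d + 1)) := by
  classical
  obtain ⟨U, hU0, hU1, hU2, hU3⟩ := Set.InjOn.exists_subset_injOn_subset_range_eq
    (f := fun j => realValue (φ j) v) (r := {g₀}) (s := {g | φ g ⬝ᵥ p = 1})
    (Set.injOn_singleton _ _) (Set.singleton_subset_iff.2 hg₀)
  refine ⟨U.toFinset, by simpa using hU0, fun g hg => hU1 (by simpa using hg), ?_⟩
  have h1 : ∀ g ∈ U, HasSeries δ {x ∈ halfOpen φ v | ∀ j, φ j ⬝ᵥ p = 1 →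
        LexNonneg (φ j ⬝ᵥ x - φ g ⬝ᵥ x) (realValue (φ j) v - realValue (φ g) v)}
      (PowerSeries.X ^ visible (φ g) v * h g * PowerSeries.mk 1 ^ (d + 1)) := by
    intro g hg
    rw [halfOpen_slice hφ hv hp hδ hp0 (hU1 hg)]
    have := (hh g (hU1 hg)).rays_from (fun x hx => zero_le_degree hφ hx) hδ (hU1 hg)
      (fun x hx => ((mem_faceLattice_project hv hp (hU1 hg)).1 hx.1).2)
      (visible_le_one (φ g) v)
    rw [pow_succ]
    convert this using 1
    ring
  rw [Finset.sum_mul]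
  have h2 := HasSeries.biUnion U.toFinset (δ := δ)
    (S := fun g => {x ∈ halfOpen φ v | ∀ j, φ j ⬝ᵥ p = 1 →
        LexNonneg (φ j ⬝ᵥ x - φ g ⬝ᵥ x) (realValue (φ j) v - realValue (φ g) v)})
    (fun g hg => h1 g (by simpa using hg)) ?_
  · convert h2 using 1
    ext x
    simp only [Set.mem_toFinset, Set.mem_iUnion, Set.mem_ofPred_eq, exists_and_left, exists_prop]
    constructor
    · intro hx
      refine ⟨hx, ?_⟩
      obtain ⟨m, hm, hmin⟩ := Finset.exists_min_image (Finset.univ.filter fun j => φ j ⬝ᵥ p = 1)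
        (fun j => toLex (φ j ⬝ᵥ x, realValue (φ j) v)) ⟨g₀, by simpa using hg₀⟩
      obtain ⟨g, hg, hgm⟩ : realValue (φ m) v ∈ (fun j => realValue (φ j) v) '' U := by
        rw [hU2]; exact ⟨m, by simpa using hm, rfl⟩
      have hgm : realValue (φ g) v = realValue (φ m) v := hgm
      -- forms with the same value at `v` agree on the lattice of the face
      have hgx : φ g ⬝ᵥ x = φ m ⬝ᵥ x := by
        have := (hv (φ g + (-1 : ℤ) • φ m)).1 (by rw [realValue_add_smul, hgm]; simp) x hx.1
        rw [add_dotProduct, smul_dotProduct] at this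
        simp only [smul_eq_mul] at this
        linarith
      refine ⟨g, hg, fun j hj => ?_⟩
      have := hmin j (by simpa using hj)
      rw [Prod.Lex.toLex_le_toLex] at this
      rw [hgx, hgm]
      simp only at this
      rcases this with h | ⟨h, h'⟩
      · left; omega
      · right; exact ⟨by omega, by linarith⟩
    · exact fun hx => hx.1
  · intro g hg g' hg' hne
    simp only [Set.coe_toFinset] at hg hg'
    rw [Function.onFun, Set.disjoint_left]
    rintro x ⟨-, hx⟩ ⟨-, hx'⟩
    have a := hx g' (hU1 hg')
    have b := hx' g (hU1 hg)
    apply hne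
    apply hU3 hg hg'
    simp only
    unfold LexNonneg at a b
    rcases a with a | ⟨a, a'⟩ <;> rcases b with b | ⟨b, b'⟩
    · omega
    · omega
    · omega
    · linarith

end Peel

/-- The numerator of a half-open compressed cone has nonnegative coefficients, and its degree is at
most the dimension; it is smaller than the dimension if the cone is half-open with respect to a
point `v` of positive degree. -/
theorem exists_numerator [Fintype J] {φ : J → ι → ℤ} {δ : ι → ℤ} (hφ : IsCompressed φ δ) :
    ∀ (d : ℕ) (v : ι → ℝ), IsGeneric φ v → Module.finrank ℤ (faceLattice φ v) = d →
      ∃ h : PowerSeries ℕ, HasSeries δ (halfOpen φ v) (h * PowerSeries.mk 1 ^ d) ∧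
        (∀ i, d < i → PowerSeries.coeff i h = 0) ∧
        (0 < realValue δ v → ∀ i, d ≤ i → PowerSeries.coeff i h = 0) := by
  intro d
  induction d with
  | zero =>
    intro v hv hd
    have hbot : faceLattice φ v = ⊥ := by
      exact Submodule.finrank_eq_zero.1 hd
    have hval : ∀ ψ, realValue ψ v = 0 := fun ψ => (hv ψ).2 (by
      rw [hbot]; intro x hx; rw [(Submodule.mem_bot ℤ).1 hx, dotProduct_zero])
    have hX : halfOpen φ v = {0} := by
      ext x
      simp only [halfOpen, hbot, Submodule.mem_bot, Set.mem_ofPred_eq, Set.mem_singleton_iff,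
        and_iff_left_iff_imp]
      rintro rfl j
      right
      simp [hval]
    refine ⟨1, ?_, fun i hi => ?_, fun h => ?_⟩
    · intro k
      rw [hX, pow_zero, mul_one, PowerSeries.coeff_one]
      rcases k with _ | k
      · have : {x ∈ ({0} : Set (ι → ℤ)) | δ ⬝ᵥ x = ((0 : ℕ) : ℤ)} = {0} := by
          ext x; simp only [Set.mem_singleton_iff, Set.mem_ofPred_eq, and_iff_left_iff_imp]
          rintro rfl; simp
        rw [this]; simp
      · have : {x ∈ ({0} : Set (ι → ℤ)) | δ ⬝ᵥ x = ((k + 1 : ℕ) : ℤ)} = ∅ := by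
          ext x; simp only [Set.mem_singleton_iff, Set.mem_ofPred_eq, Set.mem_empty_iff_false,
            iff_false, not_and]
          rintro rfl; simp; omega
        rw [this]; simp
    · rw [PowerSeries.coeff_one, if_neg (by omega)]
    · exact absurd (hval δ) h.ne'
  | succ d ih =>
    intro v hv hd
    by_cases hex : ∃ p ∈ faceLattice φ v, δ ⬝ᵥ p = 1 ∧ ∀ j, 0 ≤ φ j ⬝ᵥ p
    · obtain ⟨p, hp, hδ, hp0⟩ := hex
      have hfin : ∀ g, φ g ⬝ᵥ p = 1 →
          Module.finrank ℤ (faceLattice φ (project (φ g) p v)) = d := fun g hg => by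
        have := finrank_faceLattice_project hv hp hg
        omega
      have : ∀ g, ∃ h : PowerSeries ℕ, φ g ⬝ᵥ p = 1 →
          HasSeries δ (halfOpen φ (project (φ g) p v)) (h * PowerSeries.mk 1 ^ d) ∧
          (∀ i, d < i → PowerSeries.coeff i h = 0) ∧
          (0 < realValue δ (project (φ g) p v) → ∀ i, d ≤ i → PowerSeries.coeff i h = 0) := by
        intro g
        by_cases hg : φ g ⬝ᵥ p = 1
        · obtain ⟨h, hh⟩ := ih _ (hv.project hp hg) (hfin g hg)
          exact ⟨h, fun _ => hh⟩
        · exact ⟨0, fun h => absurd h hg⟩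
      choose h hh using this
      obtain ⟨g₀, hg₀⟩ := hφ.exists_degree
      obtain ⟨B, -, hB, hs⟩ := exists_hasSeries_peel hφ hv hp hδ hp0 d h
        (fun g hg => (hh g hg).1) g₀ (hg₀ ▸ hδ)
      refine ⟨_, hs, fun i hi => ?_, fun hpos i hi => ?_⟩
      · rw [map_sum]
        refine Finset.sum_eq_zero fun g hg => ?_
        rw [PowerSeries.coeff_X_pow_mul']
        split_ifs with hle
        · have := visible_le_one (φ g) v
          exact (hh g (hB g hg)).2.1 _ (by omega)
        · rfl
      · rw [map_sum]
        refine Finset.sum_eq_zero fun g hg => ?_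
        rw [PowerSeries.coeff_X_pow_mul']
        split_ifs with hle
        · by_cases hneg : realValue (φ g) v < 0
          · refine (hh g (hB g hg)).2.2 ?_ _ ?_
            · rw [realValue_project, hδ]; push_cast; linarith
            · have := visible_le_one (φ g) v
              omega
          · refine (hh g (hB g hg)).2.1 _ ?_
            simp only [visible, hneg, if_false]; omega
        · rfl
    · -- without a lattice point of degree one in the face, the half-open cone is empty
      have hempty : halfOpen φ v = ∅ := by
        by_contra hne
        obtain ⟨x, hx⟩ := Set.nonempty_iff_ne_empty.2 hne
        apply hex
        have key : ∀ y : ι → ℝ, y ≠ 0 → (∀ j, 0 ≤ realValue (φ j) y) →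
            (∀ j, realValue (φ j) v = 0 → realValue (φ j) y = 0) →
            ∃ p ∈ faceLattice φ v, δ ⬝ᵥ p = 1 ∧ ∀ j, 0 ≤ φ j ⬝ᵥ p := by
          intro y hy hy0 hyv
          obtain ⟨p, h1, h2, h3⟩ := hφ.round y hy hy0
          exact ⟨p, fun j hj => h3 j (hyv j hj), h1, h2⟩
        by_cases hx0 : x = 0
        · subst hx0
          refine key v ?_ ?_ fun j hj => hj
          · rintro rfl
            have : faceLattice φ (0 : ι → ℝ) = ⊥ := by
              rw [eq_bot_iff]
              intro x hx
              rw [Submodule.mem_bot]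
              have := (hv x).1 (by simp [realValue]) x hx
              exact dotProduct_self_eq_zero.1 this
            rw [this, finrank_bot] at hd
            omega
          · intro j
            have := hx.2 j
            rw [dotProduct_zero] at this
            rcases this with h | h
            · exact absurd h (lt_irrefl _)
            · exact h.2
        · refine key (fun i => (x i : ℝ)) ?_ ?_ ?_
          · intro h
            apply hx0
            ext i
            have := congrFun h i
            simpa using this
          · intro j
            rw [realValue_intCast]
            rcases hx.2 j with h | h
            · exact_mod_cast h.le
            · exact_mod_cast h.1.ge
          · intro j hj
            rw [realValue_intCast, hx.1 j hj]; simp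
      refine ⟨0, ?_, by simp, by simp⟩
      intro k
      simp [hempty]

end LatticeCone

/-! ### Flags of lattice points and a lower bound for the numerator -/

namespace LatticeCone

/-- A lattice point on which a form is positive can be decreased by points of degree one until
one of them is not in the hyperplane where the form vanishes. -/
theorem IsCompressed.exists_degree_one {ι J : Type*} [Fintype ι] {φ : J → ι → ℤ} {δ : ι → ℤ}
    (hφ : IsCompressed φ δ) {g : J} {y : ι → ℤ} (hy : ∀ j, 0 ≤ φ j ⬝ᵥ y) (hg : 0 < φ g ⬝ᵥ y) :
    ∃ p : ι → ℤ, δ ⬝ᵥ p = 1 ∧ (∀ j, 0 ≤ φ j ⬝ᵥ p) ∧ φ g ⬝ᵥ p = 1 ∧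
      ∀ j, φ j ⬝ᵥ y = 0 → φ j ⬝ᵥ p = 0 := by
  obtain ⟨j₀, hj₀⟩ := hφ.exists_degree
  induction hk : (δ ⬝ᵥ y).toNat using Nat.strong_induction_on generalizing y with
  | _ k ih =>
    obtain ⟨p, h1, h2, h3⟩ := hφ.round (fun i => (y i : ℝ))
      (by
        rintro h
        have : y = 0 := by ext i; simpa using congrFun h i
        simp [this] at hg)
      (fun j => by rw [realValue_intCast]; exact_mod_cast hy j)
    have h3' : ∀ j, φ j ⬝ᵥ y = 0 → φ j ⬝ᵥ p = 0 := fun j hj => h3 j (by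
      rw [realValue_intCast, hj]; simp)
    have hw := hφ.width p h1 h2
    by_cases hgp : φ g ⬝ᵥ p = 1
    · exact ⟨p, h1, h2, hgp, h3'⟩
    · have hgp0 : φ g ⬝ᵥ p = 0 := by have := h2 g; have := hw g; omega
      have hyp : ∀ j, 0 ≤ φ j ⬝ᵥ (y - p) := fun j => by
        rw [dotProduct_sub]
        have := h3' j; have := hy j; have := hw j
        rcases (hy j).eq_or_lt with h | h
        · rw [h3' j h.symm, ← h]; simp
        · omega
      obtain ⟨q, q1, q2, q3, q4⟩ := ih (δ ⬝ᵥ (y - p)).toNat (by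
        have := hyp j₀
        rw [hj₀] at this
        rw [dotProduct_sub, h1] at this ⊢
        omega) hyp (by rw [dotProduct_sub, hgp0]; simpa using hg) rfl
      exact ⟨q, q1, q2, q3, fun j hj => q4 j (by rw [dotProduct_sub, hj, h3' j hj]; simp)⟩

theorem realValue_single {n : ℕ} (i : Fin n) (a : ℤ) (v : Fin n → ℝ) :
    realValue (Pi.single i a) v = a * v i := by
  rw [realValue, Finset.sum_eq_single i]
  · simp
  · intro j _ hj; simp [hj]
  · simp

/-- Let the cone lie in the orthant with signs `ε`, and suppose that it meets each space
`⟨e₀, …, eₘ⟩` outside `⟨e₀, …, eₘ₋₁⟩`. If the coordinates of `v` are positive and decrease fast,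
then `t ^ s` occurs in the numerator, where `s` is the number of negative signs: peel off the
coordinates from the last to the first. -/
theorem exists_numerator_flag {n : ℕ} {J : Type*} [Fintype J] {φ : J → Fin n → ℤ} {δ : Fin n → ℤ}
    (hφ : IsCompressed φ δ) {ε : Fin n → ℤ} (hε : ∀ i, ε i = 1 ∨ ε i = -1) {g : Fin n → J}
    (hg : ∀ i, φ (g i) = Pi.single i (ε i))
    (hy : ∀ i, ∃ y : Fin n → ℤ, (∀ j, 0 ≤ φ j ⬝ᵥ y) ∧ 0 < ε i * y i ∧ ∀ i', i < i' → y i' = 0) :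
    ∀ m ≤ n, ∀ v : Fin n → ℝ, IsGeneric φ v →
      (∀ x, x ∈ faceLattice φ v ↔ ∀ i : Fin n, m ≤ i → x i = 0) →
      (∀ i : Fin n, (i : ℕ) < m → 0 < v i) →
      (∀ i i' : Fin n, i < i' → (i' : ℕ) < m → 2 ^ m * v i' < v i) →
      Module.finrank ℤ (faceLattice φ v) = m →
      ∃ h : PowerSeries ℕ, HasSeries δ (halfOpen φ v) (h * PowerSeries.mk 1 ^ m) ∧
        1 ≤ PowerSeries.coeff
          (Finset.univ.filter fun i : Fin n => (i : ℕ) < m ∧ ε i = -1).card h := by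
  intro m
  induction m with
  | zero =>
    intro _ v hv hface _ _ hd
    obtain ⟨h, hh, -⟩ := exists_numerator hφ 0 v hv hd
    refine ⟨h, hh, ?_⟩
    have hmem : (0 : Fin n → ℤ) ∈ {x ∈ halfOpen φ v | δ ⬝ᵥ x = ((0 : ℕ) : ℤ)} := by
      refine ⟨⟨Submodule.zero_mem _, fun j => Or.inr ⟨dotProduct_zero _, ?_⟩⟩, by simp⟩
      refine ((hv _).2 fun x hx => ?_).ge
      have : x = 0 := by ext i; exact (hface x).1 hx i (Nat.zero_le _)
      simp [this]
    have h0 := hh 0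
    rw [pow_zero, mul_one] at h0
    simp only [Nat.not_lt_zero, false_and, Finset.filter_false, Finset.card_empty]
    rw [← h0.2]
    exact (Set.ncard_pos h0.1).2 ⟨_, hmem⟩
  | succ m ih =>
    intro hmn v hv hface hpos hdec hd
    set q : Fin n := ⟨m, hmn⟩ with hq
    have hsingle : ∀ i (x : Fin n → ℤ), φ (g i) ⬝ᵥ x = ε i * x i := fun i x => by
      rw [hg, single_dotProduct]
    obtain ⟨y, hy0, hyq, hysupp⟩ := hy q
    obtain ⟨p, hδ, hp0, hpq, hpface⟩ := hφ.exists_degree_one (g := g q) hy0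
      (by rw [hsingle]; exact hyq)
    have hεne : ∀ i, ε i ≠ 0 := fun i => by rcases hε i with h | h <;> rw [h] <;> decide
    have hpsupp : ∀ i', q < i' → p i' = 0 := fun i' hi' => by
      have := hpface (g i') (by rw [hsingle, hysupp i' hi', mul_zero])
      rw [hsingle] at this
      exact (mul_eq_zero.1 this).resolve_left (hεne i')
    have hpbd : ∀ i, |(p i : ℝ)| ≤ 1 := fun i => by
      have h1 := hp0 (g i)
      have h2 := hφ.width p hδ hp0 (g i)
      rw [hsingle] at h1 h2
      have : |p i| ≤ 1 := by
        rw [abs_le]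
        rcases hε i with h | h <;> rw [h] at h1 h2 <;> constructor <;> linarith
      exact_mod_cast this
    have hpm : p ∈ faceLattice φ v := by
      rw [hface]
      intro i hi
      exact hpsupp i (by rw [Fin.lt_def]; exact hi)
    have hval : realValue (φ (g q)) v = ε q * v q := by rw [hg, realValue_single]
    have hvq : 0 < v q := hpos q (Nat.lt_succ_self m)
    have habs : |(ε q : ℝ) * v q| = v q := by
      rw [abs_mul, abs_of_pos hvq]
      rcases hε q with h | h <;> simp [h]
    have hdiff : ∀ i, |project (φ (g q)) p v i - v i| ≤ v q := fun i => by
      simp only [project, hval, sub_sub_cancel_left, abs_neg]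
      rw [abs_mul, habs]
      exact mul_le_of_le_one_right hvq.le (hpbd i)
    have hbig : ∀ i : Fin n, (i : ℕ) < m → 2 ^ (m + 1) * v q < v i := fun i hi =>
      hdec i q (by rw [Fin.lt_def]; exact hi) (Nat.lt_succ_self m)
    have hpow : (1 : ℝ) ≤ 2 ^ m := one_le_pow₀ (by norm_num)
    obtain ⟨h', hs', hc'⟩ := ih (by omega) (project (φ (g q)) p v) (hv.project hpm hpq)
      (fun x => by
        rw [mem_faceLattice_project hv hpm hpq, hface, hsingle]
        constructor
        · rintro ⟨h1, h2⟩ i hi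
          rcases hi.eq_or_lt with h | h
          · have : i = q := Fin.ext h.symm
            rw [this]
            exact (mul_eq_zero.1 h2).resolve_left (hεne q)
          · exact h1 i h
        · intro h
          exact ⟨fun i hi => h i (by omega), by rw [h q le_rfl, mul_zero]⟩)
      (fun i hi => by
        have := (abs_le.1 (hdiff i)).1
        have := hbig i hi
        rw [pow_succ] at this
        nlinarith)
      (fun i i' hii hi' => by
        have h1 := (abs_le.1 (hdiff i)).1
        have h2 := (abs_le.1 (hdiff i')).2
        have h3 := hbig i' hi'
        have h4 := hdec i i' hii (by omega)
        rw [pow_succ] at h3 h4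
        have h5 : (2 : ℝ) ^ m * project (φ (g q)) p v i' ≤ 2 ^ m * (v i' + v q) :=
          mul_le_mul_of_nonneg_left (by linarith) (by positivity)
        have h6 : 0 < v i' := hpos i' (by omega)
        nlinarith)
      (by have := finrank_faceLattice_project hv hpm hpq; omega)
    have : ∀ j, ∃ h : PowerSeries ℕ, φ j ⬝ᵥ p = 1 →
        HasSeries δ (halfOpen φ (project (φ j) p v)) (h * PowerSeries.mk 1 ^ m) := by
      intro j
      by_cases hj : φ j ⬝ᵥ p = 1
      · obtain ⟨h, hh, -⟩ := exists_numerator hφ m _ (hv.project hpm hj)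
          (by have := finrank_faceLattice_project hv hpm hj; omega)
        exact ⟨h, fun _ => hh⟩
      · exact ⟨0, fun h => absurd h hj⟩
    choose h hh using this
    have hhq : h (g q) = h' := mul_mk_one_pow_cancel ((hh _ hpq).unique hs')
    obtain ⟨B, hqB, -, hs⟩ := exists_hasSeries_peel hφ hv hpm hδ hp0 m h hh (g q) hpq
    refine ⟨_, hs, ?_⟩
    rw [map_sum]
    refine le_trans ?_ (Finset.single_le_sum (fun _ _ => Nat.zero_le _) hqB)
    have hcard : (Finset.univ.filter fun i : Fin n => (i : ℕ) < m + 1 ∧ ε i = -1).card =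
        (Finset.univ.filter fun i : Fin n => (i : ℕ) < m ∧ ε i = -1).card +
          visible (φ (g q)) v := by
      unfold visible
      rw [hval]
      rcases hε q with h | h
      · rw [h, if_neg (by push_cast; linarith), add_zero]
        congr 1
        ext i
        simp only [Finset.mem_filter, Finset.mem_univ, true_and, and_congr_left_iff]
        intro hi
        have : (i : ℕ) ≠ m := fun him => by
          have : i = q := Fin.ext him
          rw [this, h] at hi
          exact absurd hi (by decide)
        omega
      · rw [h, if_pos (by push_cast; linarith)]
        have : (Finset.univ.filter fun i : Fin n => (i : ℕ) < m + 1 ∧ ε i = -1) =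
            insert q (Finset.univ.filter fun i : Fin n => (i : ℕ) < m ∧ ε i = -1) := by
          ext i
          simp only [Finset.mem_filter, Finset.mem_univ, true_and, Finset.mem_insert]
          constructor
          · rintro ⟨h1, h2⟩
            rcases (Nat.lt_succ_iff.1 h1).eq_or_lt with h3 | h3
            · exact Or.inl (Fin.ext h3)
            · exact Or.inr ⟨h3, h2⟩
          · rintro (rfl | ⟨h1, h2⟩)
            · exact ⟨Nat.lt_succ_self m, h⟩
            · exact ⟨by omega, h2⟩
        rw [this, Finset.card_insert_of_notMem (by simp [hq])]
    rw [hcard, PowerSeries.coeff_X_pow_mul', if_pos (Nat.le_add_left _ _), Nat.add_sub_cancel, hhq]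
    exact hc'

/-- Powers of a large transcendental number give a vector with positive, fast decreasing coordinates
that are linearly independent over the integers. -/
theorem exists_generic (n : ℕ) (M : ℝ) :
    ∃ v : Fin n → ℝ, (∀ i, 0 < v i) ∧ (∀ i i', i < i' → M * v i' < v i) ∧
      ∀ ψ : Fin n → ℤ, realValue ψ v = 0 → ψ = 0 := by
  obtain ⟨τ, hτ, hτM⟩ :=
    ((Algebraic.countable ℤ ℝ).dense_compl ℝ).exists_gt (max M 1)
  have hτ1 : 1 < τ := (le_max_right _ _).trans_lt hτM
  have hτM : M < τ := (le_max_left _ _).trans_lt hτM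
  have hτ0 : 0 < τ := by linarith
  refine ⟨fun i => τ ^ (n - 1 - i : ℕ), fun i => by positivity, fun i i' hii => ?_, fun ψ hψ => ?_⟩
  · calc M * τ ^ (n - 1 - i' : ℕ) < τ * τ ^ (n - 1 - i' : ℕ) := by gcongr
      _ = τ ^ (n - 1 - i' + 1 : ℕ) := (pow_succ' _ _).symm
      _ ≤ τ ^ (n - 1 - i : ℕ) := pow_le_pow_right₀ hτ1.le (by
        have := i'.2; rw [Fin.lt_def] at hii; omega)
  · have htr : Transcendental ℤ τ := hτ
    set P : ℤ[X] := ∑ i : Fin n, monomial (n - 1 - i : ℕ) (ψ i) with hP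
    have h0 : aeval τ P = 0 := by
      rw [hP, map_sum, ← hψ, realValue]
      refine Finset.sum_congr rfl fun i _ => ?_
      rw [aeval_monomial]; simp
    have hP0 : P = 0 := by
      by_contra hne
      exact htr ⟨P, hne, h0⟩
    ext i
    have := congrArg (fun Q => coeff Q (n - 1 - i : ℕ)) hP0
    simp only [hP, finsetSum_coeff, coeff_monomial, coeff_zero] at this
    rw [Finset.sum_eq_single i] at this
    · simpa using this
    · intro b _ hb
      rw [if_neg]
      intro h
      apply hb
      have := b.2; have := i.2
      exact Fin.ext (by omega)
    · simp

end LatticeCone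

/-! ### The arrangement of the hyperplanes on which a row of the matrix is an integer -/

namespace LatticeCone

variable {κ : Type*} {r : ℕ}

/-- The linear forms that cut out the cone over the cell `{x | a e ≤ A e x ≤ a e + 1 for all e}` of
the arrangement of hyperplanes `A e x ∈ ℤ`. The coordinate `0` is the height in the cone, and
the height itself is one of the forms. -/
def cellForm (A : κ → Fin r → ℤ) (a : κ → ℤ) : Option (κ × Bool) → Fin (r + 1) → ℤ
  | none => Pi.single 0 1
  | some (e, false) => Fin.cons (-a e) (A e)
  | some (e, true) => Fin.cons (a e + 1) (-A e)

variable {A : κ → Fin r → ℤ} {a : κ → ℤ}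

theorem cellForm_false_dot (e : κ) (x : Fin (r + 1) → ℤ) :
    cellForm A a (some (e, false)) ⬝ᵥ x = A e ⬝ᵥ Fin.tail x - a e * x 0 := by
  simp [cellForm, dotProduct, Fin.sum_univ_succ, Fin.tail]; ring

theorem cellForm_true_dot (e : κ) (x : Fin (r + 1) → ℤ) :
    cellForm A a (some (e, true)) ⬝ᵥ x = (a e + 1) * x 0 - A e ⬝ᵥ Fin.tail x := by
  simp [cellForm, dotProduct, Fin.sum_univ_succ, Fin.tail]; ring

theorem cellForm_none_dot (x : Fin (r + 1) → ℤ) : cellForm A a none ⬝ᵥ x = x 0 := by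
  simp [cellForm]

theorem cellForm_false_realValue (e : κ) (v : Fin (r + 1) → ℝ) :
    realValue (cellForm A a (some (e, false))) v = realValue (A e) (Fin.tail v) - a e * v 0 := by
  simp [cellForm, realValue, Fin.sum_univ_succ, Fin.tail]; ring

theorem cellForm_true_realValue (e : κ) (v : Fin (r + 1) → ℝ) :
    realValue (cellForm A a (some (e, true))) v =
      (a e + 1) * v 0 - realValue (A e) (Fin.tail v) := by
  simp [cellForm, realValue, Fin.sum_univ_succ, Fin.tail]; ring

theorem cellForm_none_realValue (v : Fin (r + 1) → ℝ) :
    realValue (cellForm A a none) v = v 0 := by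
  simp [cellForm, realValue_single]

theorem cellForm_ne_zero (hA : ∀ e, A e ≠ 0) (j : Option (κ × Bool)) : cellForm A a j ≠ 0 := by
  intro h
  rcases j with _ | ⟨e, _ | _⟩
  · have := congrFun h 0; simp [cellForm] at this
  · apply hA e; ext i; have := congrFun h i.succ; simpa [cellForm] using this
  · apply hA e; ext i; have := congrFun h i.succ; simpa [cellForm] using this

/-- Every real vector `x` can be rounded to an integral vector `z` such that every row of `A`
takes at `z` the value at `x`, rounded up or down. -/
def HasRounding (A : κ → Fin r → ℤ) : Prop :=
  ∀ x : Fin r → ℝ, ∃ z : Fin r → ℤ, ∀ e,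
    ⌊realValue (A e) x⌋ ≤ A e ⬝ᵥ z ∧ A e ⬝ᵥ z ≤ ⌈realValue (A e) x⌉

theorem realValue_smul {ι : Type*} [Fintype ι] (ψ : ι → ℤ) (s : ℝ) (v : ι → ℝ) :
    realValue ψ (fun i => s * v i) = s * realValue ψ v := by
  simp only [realValue, Finset.mul_sum]
  exact Finset.sum_congr rfl fun i _ => by ring

theorem isCompressed_cellForm (c : Fin r → κ) (hc : ∀ k, A (c k) = Pi.single k 1)
    (hR : HasRounding A) (a : κ → ℤ) : IsCompressed (cellForm A a) (Pi.single 0 1) where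
  exists_degree := ⟨none, rfl⟩
  width p hp hp0 j := by
    rw [single_dotProduct, one_mul] at hp
    rcases j with _ | ⟨e, _ | _⟩
    · rw [cellForm_none_dot, hp]
    · have := hp0 (some (e, true))
      rw [cellForm_true_dot, hp] at this
      rw [cellForm_false_dot, hp]; linarith
    · have := hp0 (some (e, false))
      rw [cellForm_false_dot, hp] at this
      rw [cellForm_true_dot, hp]; linarith
  round y hy hy0 := by
    have h0 : 0 ≤ y 0 := by simpa [cellForm_none_realValue] using hy0 none
    have hpos : 0 < y 0 := by
      rcases h0.eq_or_lt with h | h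
      · exfalso
        apply hy
        ext i
        refine Fin.cases h.symm (fun k => ?_) i
        have h1 := hy0 (some (c k, false))
        have h2 := hy0 (some (c k, true))
        rw [cellForm_false_realValue, hc, realValue_single, ← h] at h1
        rw [cellForm_true_realValue, hc, realValue_single, ← h] at h2
        simp only [Fin.tail, Int.cast_one, one_mul, mul_zero, sub_zero, zero_sub] at h1 h2
        simp only [Pi.zero_apply]
        linarith
      · exact h
    obtain ⟨z, hz⟩ := hR (fun k => (y 0)⁻¹ * Fin.tail y k)
    simp only [realValue_smul] at hz
    have hlow : ∀ e, a e ≤ A e ⬝ᵥ z := fun e => by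
      refine le_trans (Int.le_floor.2 ?_) (hz e).1
      have := hy0 (some (e, false))
      rw [cellForm_false_realValue] at this
      rw [inv_mul_eq_div, le_div_iff₀ hpos]
      linarith
    have hupp : ∀ e, A e ⬝ᵥ z ≤ a e + 1 := fun e => by
      refine le_trans (hz e).2 (Int.ceil_le.2 ?_)
      have := hy0 (some (e, true))
      rw [cellForm_true_realValue] at this
      rw [inv_mul_eq_div, div_le_iff₀ hpos]
      push_cast
      linarith
    refine ⟨Fin.cons 1 z, by simp, fun j => ?_, fun j hj => ?_⟩
    · rcases j with _ | ⟨e, _ | _⟩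
      · simp [cellForm_none_dot]
      · rw [cellForm_false_dot]; simpa using hlow e
      · rw [cellForm_true_dot]; simpa using hupp e
    · rcases j with _ | ⟨e, _ | _⟩
      · rw [cellForm_none_realValue] at hj; exact absurd hj hpos.ne'
      · rw [cellForm_false_realValue] at hj
        have h1 : (y 0)⁻¹ * realValue (A e) (Fin.tail y) = (a e : ℤ) := by
          field_simp; linarith
        have h2 := hz e
        rw [h1, Int.floor_intCast, Int.ceil_intCast] at h2
        rw [cellForm_false_dot]; simp only [Fin.tail_cons, Fin.cons_zero]; omega
      · rw [cellForm_true_realValue] at hj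
        have h1 : (y 0)⁻¹ * realValue (A e) (Fin.tail y) = ((a e + 1 : ℤ) : ℝ) := by
          push_cast; field_simp; linarith
        have h2 := hz e
        rw [h1, Int.floor_intCast, Int.ceil_intCast] at h2
        rw [cellForm_true_dot]; simp only [Fin.tail_cons, Fin.cons_zero]; omega

section Generic

variable {φ : κ → Fin r → ℤ} {v : Fin r → ℝ}

theorem mem_faceLattice_of_generic (hφ : ∀ j, φ j ≠ 0) (hv : ∀ ψ, realValue ψ v = 0 → ψ = 0)
    (x : Fin r → ℤ) : x ∈ faceLattice φ v :=
  fun j hj => absurd (hv _ hj) (hφ j)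

theorem isGeneric_of_generic (hφ : ∀ j, φ j ≠ 0) (hv : ∀ ψ, realValue ψ v = 0 → ψ = 0) :
    IsGeneric φ v := by
  intro ψ
  constructor
  · intro h x _; rw [hv ψ h, zero_dotProduct]
  · intro h
    have : ψ = 0 := dotProduct_eq_zero _ fun x => h x (mem_faceLattice_of_generic hφ hv x)
    simp [this, realValue]

theorem finrank_faceLattice_of_generic (hφ : ∀ j, φ j ≠ 0)
    (hv : ∀ ψ, realValue ψ v = 0 → ψ = 0) : Module.finrank ℤ (faceLattice φ v) = r := by
  have : faceLattice φ v = ⊤ := by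
    rw [eq_top_iff]; exact fun x _ => mem_faceLattice_of_generic hφ hv x
  rw [this, finrank_top, Module.finrank_fin_fun]

end Generic

/-- The lattice points of the cone over the polytope `{x | |A e x| ≤ 1 for e ∈ S}`. -/
def slabCone (A : κ → Fin r → ℤ) (S : Set κ) : Set (Fin (r + 1) → ℤ) :=
  {x | 0 ≤ x 0 ∧ ∀ e ∈ S, |A e ⬝ᵥ Fin.tail x| ≤ x 0}

theorem lexNonneg_neg_of_not {a : ℤ} {b : ℝ} (h : ¬ LexNonneg a b) : LexNonneg (-a) (-b) := by
  unfold LexNonneg at *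
  push Not at h
  rcases h.1.lt_or_eq with h1 | h1
  · left; omega
  · right; exact ⟨by omega, by linarith [h.2 h1]⟩

/-- Any point, moved infinitesimally in the direction `v`, lies in the interior of a cell. -/
theorem exists_mem_cell (hA : ∀ e, A e ≠ 0) {v : Fin (r + 1) → ℝ}
    (hv : ∀ ψ, realValue ψ v = 0 → ψ = 0) (hv0 : 0 < v 0) {N : ℕ}
    (hvN : ∀ e, |realValue (A e) (Fin.tail v)| < N * v 0) {x : Fin (r + 1) → ℤ} (hx0 : 0 ≤ x 0)
    (hxN : ∀ e, |A e ⬝ᵥ Fin.tail x| ≤ N * x 0) :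
    ∃ a : κ → ℤ, (∀ e, -(N : ℤ) ≤ a e ∧ a e < N) ∧ x ∈ halfOpen (cellForm A a) v := by
  have key : ∀ e, ∃ b : ℤ, (-(N : ℤ) ≤ b ∧ b < N) ∧
      LexNonneg (A e ⬝ᵥ Fin.tail x - b * x 0) (realValue (A e) (Fin.tail v) - b * v 0) ∧
      ¬ LexNonneg (A e ⬝ᵥ Fin.tail x - (b + 1) * x 0)
        (realValue (A e) (Fin.tail v) - (b + 1) * v 0) := by
    intro e
    classical
    have h1 := abs_le.1 (hxN e)
    have h2 := abs_lt.1 (hvN e)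
    let P : ℕ → Prop := fun m => ¬ LexNonneg (A e ⬝ᵥ Fin.tail x - ((m : ℤ) - N : ℤ) * x 0)
      (realValue (A e) (Fin.tail v) - ((m : ℤ) - N : ℤ) * v 0)
    have hP : P (2 * N) := by
      simp only [P]
      push_cast
      rintro (h | ⟨-, h⟩)
      · linarith [h1.2]
      · linarith [h2.2]
    have hP0 : ¬ P 0 := by
      simp only [P, not_not]
      push_cast
      rcases h1.1.lt_or_eq with h | h
      · left; linarith
      · right; exact ⟨by linarith, by linarith [h2.1]⟩
    have hex : ∃ m, P m := ⟨_, hP⟩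
    obtain ⟨m, hm⟩ : ∃ m, Nat.find hex = m + 1 :=
      Nat.exists_eq_succ_of_ne_zero fun h => hP0 (h ▸ Nat.find_spec hex)
    have hm1 : P (m + 1) := hm ▸ Nat.find_spec hex
    have hm2 : ¬ P m := Nat.find_min hex (by omega)
    have hm3 : m + 1 ≤ 2 * N := hm ▸ Nat.find_min' hex hP
    refine ⟨(m : ℤ) - N, ⟨by omega, by omega⟩, not_not.1 hm2, ?_⟩
    have e1 : ((m + 1 : ℕ) : ℤ) - N = (m : ℤ) - N + 1 := by push_cast; ring
    have h3 : ¬ LexNonneg _ _ := hm1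
    rw [e1] at h3
    push_cast at h3 ⊢
    exact h3
  choose a ha hlo hup using key
  refine ⟨a, ha, mem_faceLattice_of_generic (cellForm_ne_zero hA) hv x, fun j => ?_⟩
  rcases j with _ | ⟨e, _ | _⟩
  · rw [cellForm_none_dot, cellForm_none_realValue]
    rcases hx0.eq_or_lt with h | h
    · exact Or.inr ⟨h.symm, hv0.le⟩
    · exact Or.inl h
  · rw [cellForm_false_dot, cellForm_false_realValue]
    exact hlo e
  · rw [cellForm_true_dot, cellForm_true_realValue]
    have := lexNonneg_neg_of_not (hup e)
    rwa [neg_sub, neg_sub] at this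

theorem cell_injective (hA : ∀ e, A e ≠ 0) {v : Fin (r + 1) → ℝ}
    (hv : ∀ ψ, realValue ψ v = 0 → ψ = 0) (hv0 : 0 < v 0) {x : Fin (r + 1) → ℤ} {a b : κ → ℤ}
    (ha : x ∈ halfOpen (cellForm A a) v) (hb : x ∈ halfOpen (cellForm A b) v) : a = b := by
  have main : ∀ a b : κ → ℤ, x ∈ halfOpen (cellForm A a) v → x ∈ halfOpen (cellForm A b) v →
      ∀ e, ¬ a e < b e := by
    intro a b ha hb e hlt
    have h0 := ha.2 none
    have h1 := ha.2 (some (e, true))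
    have h2 := hb.2 (some (e, false))
    rw [cellForm_none_dot] at h0
    rw [cellForm_true_dot, cellForm_true_realValue] at h1
    rw [cellForm_false_dot, cellForm_false_realValue] at h2
    have hx0 : 0 ≤ x 0 := by rcases h0 with h | h; exacts [h.le, h.1.ge]
    have i1 : (a e + 1) * x 0 ≤ b e * x 0 := mul_le_mul_of_nonneg_right hlt hx0
    have hlt' : (a e : ℝ) + 1 ≤ b e := by exact_mod_cast hlt
    have i2 : ((a e : ℝ) + 1) * v 0 ≤ b e * v 0 := mul_le_mul_of_nonneg_right hlt' hv0.le
    have h3 : realValue (cellForm A b (some (e, false))) v = 0 := by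
      rw [cellForm_false_realValue]
      rcases h1 with h1 | ⟨h1, h1'⟩ <;> rcases h2 with h2 | ⟨h2, h2'⟩ <;> linarith
    exact cellForm_ne_zero hA _ (hv _ h3)
  ext e
  have := main a b ha hb e
  have := main b a hb ha e
  omega

/-- A point of the cone over the cell `a` lies between the hyperplanes `A e x = ± 1` if and only if
the cell does. -/
theorem cell_slab {v : Fin (r + 1) → ℝ} (hv0 : 0 < v 0) {e : κ}
    (hve : |realValue (A e) (Fin.tail v)| < v 0) {x : Fin (r + 1) → ℤ} {a : κ → ℤ}
    (ha : x ∈ halfOpen (cellForm A a) v) :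
    |A e ⬝ᵥ Fin.tail x| ≤ x 0 ↔ a e = -1 ∨ a e = 0 := by
  have h0 := ha.2 none
  have h1 := ha.2 (some (e, true))
  have h2 := ha.2 (some (e, false))
  rw [cellForm_none_dot] at h0
  rw [cellForm_true_dot, cellForm_true_realValue] at h1
  rw [cellForm_false_dot, cellForm_false_realValue] at h2
  have hx0 : 0 ≤ x 0 := by rcases h0 with h | h; exacts [h.le, h.1.ge]
  rw [abs_lt] at hve
  constructor
  · intro hx
    rw [abs_le] at hx
    by_contra hne
    rcases lt_or_ge (a e) (-1) with hlt | hge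
    · have hle : a e + 1 ≤ -1 := by omega
      have hle' : (a e : ℝ) + 1 ≤ -1 := by exact_mod_cast hle
      have i1 : (a e + 1) * x 0 ≤ (-1) * x 0 := mul_le_mul_of_nonneg_right hle hx0
      have i2 : ((a e : ℝ) + 1) * v 0 ≤ (-1) * v 0 := mul_le_mul_of_nonneg_right hle' hv0.le
      rcases h1 with h1 | ⟨-, h1⟩ <;> linarith
    · have hle : 1 ≤ a e := by omega
      have hle' : (1 : ℝ) ≤ a e := by exact_mod_cast hle
      have i1 : 1 * x 0 ≤ a e * x 0 := mul_le_mul_of_nonneg_right hle hx0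
      have i2 : 1 * v 0 ≤ a e * v 0 := mul_le_mul_of_nonneg_right hle' hv0.le
      rcases h2 with h2 | ⟨-, h2⟩ <;> linarith
  · have h1' : 0 ≤ (a e + 1) * x 0 - A e ⬝ᵥ Fin.tail x := by
      rcases h1 with h | h; exacts [h.le, h.1.ge]
    have h2' : 0 ≤ A e ⬝ᵥ Fin.tail x - a e * x 0 := by
      rcases h2 with h | h; exacts [h.le, h.1.ge]
    rw [abs_le]
    rintro (h | h) <;> rw [h] at h1' h2' <;> constructor <;> linarith

theorem dotProduct_abs_le {n : ℕ} (b x : Fin n → ℤ) {M : ℤ} (hx : ∀ k, |x k| ≤ M) :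
    |b ⬝ᵥ x| ≤ (∑ k, |b k|) * M := by
  rw [dotProduct, Finset.sum_mul]
  refine (Finset.abs_sum_le_sum_abs _ _).trans (Finset.sum_le_sum fun k _ => ?_)
  rw [abs_mul]
  exact mul_le_mul_of_nonneg_left (hx k) (abs_nonneg _)

theorem realValue_abs_lt {n : ℕ} (b : Fin n → ℤ) (x : Fin n → ℝ) {M w : ℝ} (hw : 0 < w)
    (hM : ((∑ k, |b k| : ℤ) : ℝ) < M) (hx : ∀ k, M * |x k| < w) : |realValue b x| < w := by
  have hM0 : 0 < M := lt_of_le_of_lt (by positivity) hM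
  calc |realValue b x| ≤ ∑ k, |(b k : ℝ)| * |x k| := by
        refine (Finset.abs_sum_le_sum_abs _ _).trans (le_of_eq ?_)
        exact Finset.sum_congr rfl fun k _ => abs_mul _ _
    _ ≤ ∑ k, |(b k : ℝ)| * (w / M) := by
        refine Finset.sum_le_sum fun k _ => mul_le_mul_of_nonneg_left ?_ (abs_nonneg _)
        rw [le_div_iff₀ hM0, mul_comm]
        exact (hx k).le
    _ = ((∑ k, |b k| : ℤ) : ℝ) * (w / M) := by rw [← Finset.sum_mul]; push_cast; rfl
    _ < M * (w / M) := mul_lt_mul_of_pos_right hM (by positivity)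
    _ = w := by field_simp

/-- The cone over `{x | |A e x| ≤ 1 for e ∈ S}` is the disjoint union of the half-open cones over
the cells contained in this polytope. -/
theorem slabCone_eq_iUnion [Fintype κ] [DecidableEq κ] (hA : ∀ e, A e ≠ 0) {v : Fin (r + 1) → ℝ}
    (hv : ∀ ψ, realValue ψ v = 0 → ψ = 0) (hv0 : 0 < v 0) {N : ℕ} (hN : 1 ≤ N)
    (hve : ∀ e, |realValue (A e) (Fin.tail v)| < v 0) (hAN : ∀ e, ∑ k, |A e k| ≤ N)
    (c : Fin r → κ) (hc : ∀ k, A (c k) = Pi.single k 1) {S : Set κ} [DecidablePred (· ∈ S)]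
    (hS : ∀ k, c k ∈ S) :
    slabCone A S = ⋃ a ∈ (Fintype.piFinset fun _ : κ => Finset.Ico (-(N : ℤ)) N).filter
      (fun a => ∀ e ∈ S, a e = -1 ∨ a e = 0), halfOpen (cellForm A a) v := by
  ext x
  simp only [Set.mem_iUnion, Finset.mem_filter, Fintype.mem_piFinset, Finset.mem_Ico, exists_prop]
  constructor
  · rintro ⟨hx0, hx⟩
    have hxk : ∀ k, |Fin.tail x k| ≤ x 0 := fun k => by
      have := hx (c k) (hS k)
      rwa [hc, single_dotProduct, one_mul] at this
    have hN' : (1 : ℝ) ≤ N := by exact_mod_cast hN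
    obtain ⟨a, ha, hxa⟩ := exists_mem_cell (N := N) hA hv hv0
      (fun e => (hve e).trans_le (le_mul_of_one_le_left hv0.le hN')) hx0
      (fun e => (dotProduct_abs_le _ _ hxk).trans (mul_le_mul_of_nonneg_right (hAN e) hx0))
    exact ⟨a, ⟨ha, fun e he => (cell_slab hv0 (hve e) hxa).1 (hx e he)⟩, hxa⟩
  · rintro ⟨a, ⟨-, ha⟩, hx⟩
    refine ⟨?_, fun e he => (cell_slab hv0 (hve e) hx).2 (ha e he)⟩
    have h0 := hx.2 none
    rw [cellForm_none_dot] at h0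
    rcases h0 with h | h; exacts [h.le, h.1.ge]

end LatticeCone

/-! ### The bounds for the numerators -/

namespace LatticeCone

variable {κ : Type*} {r : ℕ} {A : κ → Fin r → ℤ}

/-- In every orthant there is a cell at the origin such that the cone over it meets each space
`⟨e₀, …, eᵢ⟩` outside `⟨e₀, …, eᵢ₋₁⟩`: the one that contains the points `δ (ε₁, δ ε₂, δ² ε₃, …)` for
all small `δ > 0`. -/
theorem exists_flag_cell {N : ℕ} (hAN : ∀ e, ∑ k, |A e k| ≤ N) (c : Fin r → κ)
    (hc : ∀ k, A (c k) = Pi.single k 1) {ε : Fin (r + 1) → ℤ} (hε : ∀ i, ε i = 1 ∨ ε i = -1)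
    (hε0 : ε 0 = 1) :
    ∃ a : κ → ℤ, (∀ e, a e = -1 ∨ a e = 0) ∧ (∀ k, a (c k) = if ε k.succ = 1 then 0 else -1) ∧
      ∀ i, ∃ y : Fin (r + 1) → ℤ, (∀ j, 0 ≤ cellForm A a j ⬝ᵥ y) ∧ 0 < ε i * y i ∧
        ∀ i', i < i' → y i' = 0 := by
  set B : ℤ := N + 1 with hB
  have hB0 : 0 < B := by positivity
  set Y : ℕ → Fin (r + 1) → ℤ := fun m i => if (i : ℕ) ≤ m then ε i * B ^ (m - i : ℕ) else 0 with hY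
  set S : κ → ℕ → ℤ := fun e m => A e ⬝ᵥ Fin.tail (Y m) with hS
  have hεabs : ∀ i, |ε i| = 1 := fun i => by rcases hε i with h | h <;> simp [h]
  have hS0 : ∀ e, S e 0 = 0 := fun e => by
    have : Fin.tail (Y 0) = 0 := by ext k; simp [hY, Fin.tail]
    simp [hS, this]
  have hstep : ∀ e m, |S e (m + 1) - B * S e m| ≤ N := by
    intro e m
    have h1 : Fin.tail (Y (m + 1)) =
        B • Fin.tail (Y m) + fun k : Fin r => if (k : ℕ) = m then ε k.succ else 0 := by
      ext k
      simp only [hY, Fin.tail, Fin.val_succ, Pi.add_apply, Pi.smul_apply, smul_eq_mul]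
      rcases lt_trichotomy (k : ℕ) m with h | h | h
      · rw [if_pos (by omega), if_pos (by omega), if_neg (by omega)]
        have : m + 1 - (k + 1 : ℕ) = m - (k + 1 : ℕ) + 1 := by omega
        rw [this, pow_succ]; ring
      · simp [h]
      · rw [if_neg (by omega), if_neg (by omega), if_neg (by omega)]; simp
    have h2 : S e (m + 1) - B * S e m =
        A e ⬝ᵥ fun k : Fin r => if (k : ℕ) = m then ε k.succ else 0 := by
      simp only [hS, h1, dotProduct_add, dotProduct_smul, smul_eq_mul]; ring
    rw [h2]
    refine (dotProduct_abs_le (M := 1) _ _ fun k => ?_).trans (by simpa using hAN e)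
    split_ifs
    · exact (hεabs _).le
    · simp
  have hbound : ∀ e m, |S e m| ≤ B ^ m - 1 := by
    intro e m
    induction m with
    | zero => simp [hS0]
    | succ m ih =>
      have := abs_le.1 (hstep e m)
      have ih := abs_le.1 ih
      rw [pow_succ, abs_le]
      constructor <;> nlinarith
  have hposup : ∀ e m, 0 < S e m → ∀ m', m ≤ m' → 0 < S e m' := by
    intro e m hm m' hm'
    induction m', hm' using Nat.le_induction with
    | base => exact hm
    | succ m' _ ih => have := abs_le.1 (hstep e m'); nlinarith
  have hnegup : ∀ e m, S e m < 0 → ∀ m', m ≤ m' → S e m' < 0 := by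
    intro e m hm m' hm'
    induction m', hm' using Nat.le_induction with
    | base => exact hm
    | succ m' _ ih => have := abs_le.1 (hstep e m'); nlinarith
  refine ⟨fun e => if 0 ≤ S e r then 0 else -1, fun e => ?_, fun k => ?_,
    fun i => ⟨Y i, ?_, ?_, ?_⟩⟩
  · dsimp only; split_ifs <;> simp
  · have : S (c k) r = ε k.succ * B ^ (r - (k + 1) : ℕ) := by
      simp only [hS, hc, single_dotProduct, one_mul, hY, Fin.tail, Fin.val_succ]
      rw [if_pos (by omega)]
    dsimp only
    rw [this]
    have hpos : 0 < B ^ (r - (k + 1) : ℕ) := pow_pos hB0 _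
    rcases hε k.succ with h | h
    · rw [h, if_pos (by linarith), if_pos rfl]
    · rw [h, if_neg (by linarith), if_neg (by decide)]
  · have hY0 : Y i 0 = B ^ (i : ℕ) := by simp [hY, hε0]
    have hb : ∀ e, |S e i| ≤ B ^ (i : ℕ) - 1 := fun e => hbound e i
    have hpos : 0 < B ^ (i : ℕ) := pow_pos hB0 _
    intro j
    rcases j with _ | ⟨e, _ | _⟩
    · rw [cellForm_none_dot, hY0]; exact hpos.le
    · rw [cellForm_false_dot, hY0]
      change 0 ≤ S e i - _
      have := abs_le.1 (hb e)
      split_ifs with h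
      · have : ¬ S e i < 0 := fun h' => absurd (hnegup e i h' r (by omega)) (by omega)
        linarith
      · linarith
    · rw [cellForm_true_dot, hY0]
      change 0 ≤ _ - S e i
      have := abs_le.1 (hb e)
      split_ifs with h
      · linarith
      · have : ¬ 0 < S e i := fun h' => absurd (hposup e i h' r (by omega)) (by omega)
        linarith
  · have : ε i * Y i i = 1 := by
      simp only [hY, le_refl, if_true, Nat.sub_self, pow_zero, mul_one]
      rcases hε i with h | h <;> simp [h]
    rw [this]; exact one_pos
  · intro i' hi'
    simp only [hY]
    rw [if_neg (by rw [Fin.lt_def] at hi'; omega)]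

/-- The bounds for the numerators of `{x | |A e x| ≤ 1 for all e}` and of the cube. Both polytopes
are unions of cells, and the cube has more of them. For every sign vector there is a
cell in the smaller polytope that contributes `t ^ s`, where `s` is the number of negative signs. -/
theorem exists_numerator_bounds [Fintype κ] (hA : ∀ e, A e ≠ 0) (c : Fin r → κ)
    (hc : ∀ k, A (c k) = Pi.single k 1) (hR : HasRounding A) :
    ∃ h hQ : PowerSeries ℕ,
      HasSeries (Pi.single 0 1) (slabCone A Set.univ) (h * PowerSeries.mk 1 ^ (r + 1)) ∧
      HasSeries (Pi.single 0 1) (slabCone A (Set.range c)) (hQ * PowerSeries.mk 1 ^ (r + 1)) ∧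
      ∀ i, r.choose i ≤ PowerSeries.coeff i h ∧ PowerSeries.coeff i h ≤ PowerSeries.coeff i hQ ∧
        (r < i → PowerSeries.coeff i hQ = 0) := by
  classical
  obtain ⟨N, hN1, hAN⟩ : ∃ N : ℕ, 1 ≤ N ∧ ∀ e, ∑ k, |A e k| ≤ N := by
    refine ⟨(∑ e, ∑ k, |A e k|).toNat + 1, by omega, fun e => ?_⟩
    have := Finset.single_le_sum (f := fun e => ∑ k, |A e k|) (fun e _ => by positivity)
      (Finset.mem_univ e)
    omega
  obtain ⟨v, hvpos, hvdec, hv⟩ := exists_generic (r + 1) (max (2 ^ (r + 1)) (N + 1))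
  have hv0 := hvpos 0
  have hve : ∀ e, |realValue (A e) (Fin.tail v)| < v 0 := fun e => by
    refine realValue_abs_lt (M := N + 1) _ _ hv0 ?_ fun k => ?_
    · have : ((∑ k, |A e k| : ℤ) : ℝ) ≤ N := by exact_mod_cast hAN e
      linarith
    · have h1 : Fin.tail v k = v k.succ := rfl
      rw [h1, abs_of_pos (hvpos _)]
      exact (mul_le_mul_of_nonneg_right (le_max_right _ _) (hvpos _).le).trans_lt
        (hvdec 0 k.succ (Fin.succ_pos k))
  have hne := fun a : κ → ℤ => cellForm_ne_zero (a := a) hA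
  have hcell := isCompressed_cellForm c hc hR
  have hgen := fun a => isGeneric_of_generic (hne a) hv
  have hrank := fun a => finrank_faceLattice_of_generic (hne a) hv
  choose h hh h1 h2 using fun a => exists_numerator (hcell a) (r + 1) v (hgen a) (hrank a)
  have hdisj : ∀ T : Finset (κ → ℤ),
      (T : Set (κ → ℤ)).PairwiseDisjoint fun a => halfOpen (cellForm A a) v := by
    intro T a _ b _ hab
    rw [Function.onFun, Set.disjoint_left]
    exact fun x hxa hxb => hab (cell_injective hA hv hv0 hxa hxb)
  set T : Set κ → Finset (κ → ℤ) := fun S =>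
    (Fintype.piFinset fun _ : κ => Finset.Ico (-(N : ℤ)) N).filter
      (fun a => ∀ e ∈ S, a e = -1 ∨ a e = 0) with hT
  have hser : ∀ S : Set κ, (∀ k, c k ∈ S) →
      HasSeries (Pi.single 0 1) (slabCone A S) ((∑ a ∈ T S, h a) * PowerSeries.mk 1 ^ (r + 1)) := by
    intro S hS
    rw [slabCone_eq_iUnion hA hv hv0 hN1 hve hAN c hc hS, Finset.sum_mul]
    exact HasSeries.biUnion _ (fun a _ => hh a) (hdisj _)
  refine ⟨_, _, hser Set.univ fun _ => trivial, hser (Set.range c) fun k => ⟨k, rfl⟩,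
    fun i => ⟨?_, ?_, fun hi => ?_⟩⟩
  · -- one cell for every set `I` of negative coordinates
    set ε : Finset (Fin r) → Fin (r + 1) → ℤ :=
      fun I => Fin.cons 1 fun k => if k ∈ I then -1 else 1 with hεdef
    have hε : ∀ I i, ε I i = 1 ∨ ε I i = -1 := by
      intro I i
      refine Fin.cases (Or.inl rfl) (fun k => ?_) i
      simp only [hεdef, Fin.cons_succ]
      split_ifs <;> simp
    choose a ha1 ha2 ha3 using fun I => exists_flag_cell hAN c hc (hε I) rfl
    have hmem : ∀ I, a I ∈ T Set.univ := by
      intro I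
      simp only [hT, Finset.mem_filter, Fintype.mem_piFinset, Finset.mem_Ico]
      refine ⟨fun e => ?_, fun e _ => ha1 I e⟩
      rcases ha1 I e with h | h <;> rw [h] <;> constructor <;> omega
    have hac : ∀ I k, a I (c k) = if k ∈ I then -1 else 0 := by
      intro I k
      rw [ha2]
      simp only [hεdef, Fin.cons_succ]
      split_ifs <;> simp_all
    have hinj : Function.Injective a := by
      intro I I' hII
      ext k
      have h1 := hac I k
      have h2 := hac I' k
      rw [hII, h2] at h1
      by_cases hk : k ∈ I <;> by_cases hk' : k ∈ I' <;> simp_all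
    have hcoeff : ∀ I, 1 ≤ PowerSeries.coeff I.card (h (a I)) := by
      intro I
      obtain ⟨h', hs', hc'⟩ := exists_numerator_flag (hcell (a I)) (hε I)
        (g := Fin.cons none fun k => some (c k, decide (k ∈ I))) (fun i => by
          refine Fin.cases rfl (fun k => ?_) i
          simp only [Fin.cons_succ, hεdef]
          ext l
          by_cases hk : k ∈ I
          · simp only [hk, decide_true, cellForm, hac, hc, if_true]
            refine Fin.cases ?_ (fun l => ?_) l
            · simp
            · by_cases hl : l = k <;> simp [hl]
          · simp only [hk, decide_false, cellForm, hac, hc, if_false]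
            refine Fin.cases ?_ (fun l => ?_) l
            · simp
            · by_cases hl : l = k <;> simp [hl])
        (ha3 I) (r + 1) le_rfl v (hgen _)
        (fun x => ⟨fun _ i hi => absurd i.2 (by omega),
          fun _ => mem_faceLattice_of_generic (hne _) hv x⟩)
        (fun i _ => hvpos i)
        (fun i i' hii _ => (mul_le_mul_of_nonneg_right (le_max_left _ _) (hvpos _).le).trans_lt
          (hvdec i i' hii)) (hrank _)
      have heq : h (a I) = h' := mul_mk_one_pow_cancel ((hh (a I)).unique hs')
      have hcard : I.card =
          (Finset.univ.filter fun i : Fin (r + 1) => (i : ℕ) < r + 1 ∧ ε I i = -1).card := by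
        rw [← Finset.card_map (Fin.succEmb r)]
        congr 1
        ext i
        simp only [Finset.mem_map, Fin.coe_succEmb, Finset.mem_filter, Finset.mem_univ, true_and,
          i.2]
        refine Fin.cases ?_ (fun k => ?_) i
        · simp [hεdef]
        · simp only [hεdef, Fin.cons_succ, Fin.succ_inj, exists_eq_right]
          split_ifs with hk <;> simp [hk]
      rw [heq, hcard]
      exact hc'
    rw [map_sum]
    calc r.choose i = ∑ I ∈ (Finset.univ : Finset (Fin r)).powersetCard i, 1 := by simp
      _ ≤ ∑ I ∈ (Finset.univ : Finset (Fin r)).powersetCard i, PowerSeries.coeff i (h (a I)) := by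
          refine Finset.sum_le_sum fun I hI => ?_
          rw [← (Finset.mem_powersetCard.1 hI).2]
          exact hcoeff I
      _ = ∑ b ∈ ((Finset.univ : Finset (Fin r)).powersetCard i).image a,
            PowerSeries.coeff i (h b) := by
          rw [Finset.sum_image fun _ _ _ _ h => hinj h]
      _ ≤ _ := Finset.sum_le_sum_of_subset fun b hb => by
          obtain ⟨I, -, rfl⟩ := Finset.mem_image.1 hb
          exact hmem I
  · rw [map_sum, map_sum]
    refine Finset.sum_le_sum_of_subset fun a ha => ?_
    simp only [hT, Finset.mem_filter] at ha ⊢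
    exact ⟨ha.1, fun e _ => ha.2 e trivial⟩
  · rw [map_sum]
    refine Finset.sum_eq_zero fun a _ => h2 a ?_ i hi
    rw [realValue_single, Int.cast_one, one_mul]
    exact hv0

end LatticeCone

/-! ### Circulations of a directed graph -/

namespace DirMultigraph

variable {V : Type u} {E : Type v}

section Boundary

variable [Fintype E] (G : DirMultigraph V E) (R : Type*) [CommRing R]

open Classical in
/-- The boundary operator: an edge is mapped to its head minus its tail. Its kernel consists of the
flows (circulations) of the graph. -/
noncomputable def boundary : (E → R) →ₗ[R] V → R :=
  Fintype.linearCombination R fun e => Pi.single (G.head e) 1 - Pi.single (G.tail e) 1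

open Classical in
theorem boundary_apply (f : E → R) (w : V) :
    G.boundary R f w =
      ∑ e, f e * ((if w = G.head e then 1 else 0) - (if w = G.tail e then 1 else 0)) := by
  simp [boundary, Fintype.linearCombination_apply, Pi.single_apply]

open Classical in
theorem boundary_single (e : E) :
    G.boundary R (Pi.single e 1) = Pi.single (G.head e) 1 - Pi.single (G.tail e) 1 := by
  simp [boundary]

theorem sum_boundary [Fintype V] (f : E → R) : ∑ w, G.boundary R f w = 0 := by
  classical
  simp only [boundary_apply]
  rw [Finset.sum_comm]
  refine Finset.sum_eq_zero fun e _ => ?_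
  rw [← Finset.mul_sum, Finset.sum_sub_distrib]
  simp

theorem boundary_intCast (f : E → ℤ) (w : V) :
    G.boundary ℝ (fun e => (f e : ℝ)) w = (G.boundary ℤ f w : ℤ) := by
  simp only [boundary_apply]
  push_cast
  rfl

end Boundary

section Chain

variable (G : DirMultigraph V E)

open Classical in
/-- The sign vector of a list of steps, with multiplicities. -/
noncomputable def chain (R : Type*) [CommRing R] (l : List (E × Bool)) : E → R :=
  (l.map fun s => if s.2 then Pi.single s.1 1 else -Pi.single s.1 1).sum

open Classical in
theorem chain_cons (R : Type*) [CommRing R] (s : E × Bool) (l : List (E × Bool)) :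
    chain R (s :: l) = (if s.2 then Pi.single s.1 1 else -Pi.single s.1 1) + chain R l := by
  simp [chain]

open Classical in
theorem boundary_chain [Fintype E] (R : Type*) [CommRing R] {u w : V} {l : List (E × Bool)}
    (h : G.IsWalk u w l) :
    G.boundary R (chain R l) = Pi.single w 1 - Pi.single u 1 := by
  induction l generalizing u with
  | nil => obtain rfl : u = w := h; simp [chain]
  | cons s l ih =>
    obtain ⟨rfl, h⟩ := h
    rw [chain_cons, map_add, ih h]
    rcases s with ⟨e, _ | _⟩
    · simp [boundary_single, src, tgt]
    · simp [boundary_single, src, tgt]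

theorem chain_eq_zero (R : Type*) [CommRing R] {l : List (E × Bool)} {e : E}
    (h : ∀ s ∈ l, s.1 ≠ e) : chain R l e = 0 := by
  classical
  induction l with
  | nil => simp [chain]
  | cons s l ih =>
    have h1 := h s List.mem_cons_self
    rw [chain_cons, Pi.add_apply, ih fun s' hs' => h s' (List.mem_cons_of_mem _ hs')]
    split_ifs <;> simp [h1.symm]

open Classical in
/-- A path does not use an edge twice, so the entries of its sign vector are `0`, `1` and `-1`. -/
theorem chain_of_nodup {u w : V} {l : List (E × Bool)} (h : G.IsWalk u w l)
    (hn : (u :: l.map G.tgt).Nodup) (e : E) :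
    chain ℤ l e = if (e, true) ∈ l then 1 else if (e, false) ∈ l then -1 else 0 := by
  induction l generalizing u with
  | nil => simp [chain]
  | cons s l ih =>
    obtain ⟨rfl, h⟩ := h
    rw [List.map_cons] at hn
    have hn1 := (List.nodup_cons.1 hn).1
    have hn2 := (List.nodup_cons.1 hn).2
    have hn3 := (List.nodup_cons.1 hn2).1
    rw [chain_cons, Pi.add_apply, ih h hn2]
    have h1 : s ∉ l := fun hs => hn3 (List.mem_map_of_mem hs)
    have h2 : (s.1, !s.2) ∉ l := fun hs => hn1 (by
      have := List.mem_map_of_mem (f := G.tgt) hs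
      have e1 : G.tgt (s.1, !s.2) = G.src s := by rcases s with ⟨e, _ | _⟩ <;> rfl
      rw [e1] at this
      exact List.mem_cons_of_mem _ this)
    rcases s with ⟨e', _ | _⟩
    · by_cases he : e = e'
      · subst he
        have h2' : (e, true) ∉ l := h2
        simp [h1, h2']
      · simp [he]
    · by_cases he : e = e'
      · subst he
        have h2' : (e, false) ∉ l := h2
        simp [h1, h2']
      · simp [he]

end Chain

section Rounding

variable [Fintype V] [Fintype E] (G : DirMultigraph V E)

/-- If some values of a flow are fractional, then there is a nonzero flow on the edges where this
happens: by conservation each vertex is incident with no or with at least two ends of such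
edges, so there are at least as many of these edges as vertices that they meet, which is more than
the number of independent conservation laws. -/
theorem exists_flow_on_fractional {f : E → ℝ} (hf : G.boundary ℝ f = 0) {D : Finset E}
    (hD : ∀ e, e ∉ D ↔ ∃ n : ℤ, (n : ℝ) = f e) (hne : D.Nonempty) :
    ∃ c : E → ℝ, c ≠ 0 ∧ G.boundary ℝ c = 0 ∧ ∀ e ∉ D, c e = 0 := by
  classical
  set H : Finset (E × Bool) := D ×ˢ Finset.univ with hH
  set W : Finset V := H.image G.src with hW
  have hfib : ∀ w ∈ W, 2 ≤ (H.filter fun s => G.src s = w).card := by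
    intro w hw
    obtain ⟨s, hs, hsw⟩ := Finset.mem_image.1 hw
    by_contra hlt
    have huniq : ∀ s' ∈ H, G.src s' = w → s' = s := fun s' hs' hw' =>
      Finset.card_le_one.1 (by omega : (H.filter fun s => G.src s = w).card ≤ 1) s'
        (Finset.mem_filter.2 ⟨hs', hw'⟩) s (Finset.mem_filter.2 ⟨hs, hsw⟩)
    have hsD : s.1 ∈ D := (Finset.mem_product.1 hs).1
    have hno : ∀ e ∈ D, ∀ b, (e, b) ≠ s → G.src (e, b) ≠ w := fun e he b hb h =>
      hb (huniq _ (Finset.mem_product.2 ⟨he, Finset.mem_univ _⟩) h)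
    have h0 : G.boundary ℝ f w = 0 := by rw [hf]; rfl
    rw [boundary_apply, ← Finset.add_sum_erase _ _ (Finset.mem_univ s.1)] at h0
    have hint : ∑ e ∈ Finset.univ.erase s.1, f e *
        ((if w = G.head e then 1 else 0) - (if w = G.tail e then 1 else 0)) ∈
        (Int.castRingHom ℝ).range := by
      refine sum_mem fun e he => ?_
      have he1 : e ≠ s.1 := Finset.ne_of_mem_erase he
      by_cases heD : e ∈ D
      · have h1 : ¬ w = G.head e := fun h => hno e heD false (fun h' => he1 (by rw [← h'])) h.symm
        have h2 : ¬ w = G.tail e := fun h => hno e heD true (fun h' => he1 (by rw [← h'])) h.symm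
        rw [if_neg h1, if_neg h2]; simp [zero_mem]
      · obtain ⟨n, hn⟩ := (hD e).1 heD
        refine mul_mem ⟨n, by simpa using hn⟩ (sub_mem ?_ ?_) <;> split_ifs <;>
          first | exact one_mem _ | exact zero_mem _
    obtain ⟨n, hn⟩ := hint
    rw [← hn] at h0
    refine absurd hsD ((hD s.1).2 ?_)
    rcases s with ⟨e, _ | _⟩
    · have h1 : w = G.head e := hsw.symm
      have h2 : ¬ w = G.tail e := fun h => hno e hsD true (by simp) h.symm
      simp only [if_pos h1, if_neg h2] at h0
      exact ⟨-n, by push_cast; simp at h0; linarith⟩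
    · have h1 : w = G.tail e := hsw.symm
      have h2 : ¬ w = G.head e := fun h => hno e hsD false (by simp) h.symm
      simp only [if_pos h1, if_neg h2] at h0
      exact ⟨n, by simp at h0; linarith⟩
  have hcard : W.card ≤ D.card := by
    have h1 : H.card = ∑ w ∈ W, (H.filter fun s => G.src s = w).card :=
      Finset.card_eq_sum_card_image _ _
    have h2 : W.card * 2 ≤ ∑ w ∈ W, (H.filter fun s => G.src s = w).card := by
      rw [← smul_eq_mul]
      exact Finset.card_nsmul_le_sum _ _ _ hfib
    have h3 : H.card = D.card * 2 := by simp [hH, Finset.card_product]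
    omega
  obtain ⟨e₀, he₀⟩ := hne
  have hw₀ : G.src (e₀, true) ∈ W :=
    Finset.mem_image_of_mem _ (Finset.mem_product.2 ⟨he₀, Finset.mem_univ _⟩)
  set w₀ := G.src (e₀, true)
  let Φ : (E → ℝ) →ₗ[ℝ] ({w // w ∈ W.erase w₀} ⊕ {e // e ∉ D} → ℝ) :=
    LinearMap.pi fun i => Sum.rec (fun w => (LinearMap.proj w.1).comp (G.boundary ℝ))
      (fun e => LinearMap.proj e.1) i
  have hker : LinearMap.ker Φ ≠ ⊥ := by
    apply LinearMap.ker_ne_bot_of_finrank_lt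
    rw [Module.finrank_fintype_fun_eq_card, Module.finrank_fintype_fun_eq_card, Fintype.card_sum,
      Fintype.card_coe, Finset.card_erase_of_mem hw₀, Fintype.card_subtype_compl, Fintype.card_coe]
    have : 0 < W.card := Finset.card_pos.2 ⟨_, hw₀⟩
    have := Finset.card_le_univ D
    omega
  obtain ⟨c, hc, hc0⟩ := Submodule.exists_mem_ne_zero_of_ne_bot hker
  have hcD : ∀ e ∉ D, c e = 0 := fun e he => congrFun (LinearMap.mem_ker.1 hc) (Sum.inr ⟨e, he⟩)
  have hcW : ∀ w ∈ W, w ≠ w₀ → G.boundary ℝ c w = 0 := fun w hw hne =>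
    congrFun (LinearMap.mem_ker.1 hc) (Sum.inl ⟨w, Finset.mem_erase.2 ⟨hne, hw⟩⟩)
  have hcV : ∀ w, w ≠ w₀ → G.boundary ℝ c w = 0 := by
    intro w hne
    by_cases hw : w ∈ W
    · exact hcW w hw hne
    · rw [boundary_apply]
      refine Finset.sum_eq_zero fun e _ => ?_
      by_cases he : e ∈ D
      · have h1 : ∀ b, ¬ w = G.src (e, b) := fun b h => hw (h ▸
          Finset.mem_image_of_mem _ (Finset.mem_product.2 ⟨he, Finset.mem_univ _⟩))
        have h2 : ¬ w = G.head e := h1 false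
        have h3 : ¬ w = G.tail e := h1 true
        simp [h2, h3]
      · rw [hcD e he, zero_mul]
  refine ⟨c, hc0, ?_, hcD⟩
  ext w
  by_cases hw : w = w₀
  · subst hw
    have := G.sum_boundary ℝ c
    rwa [Finset.sum_eq_single_of_mem _ (Finset.mem_univ _) fun w _ h => hcV w h] at this
  · exact hcV w hw

/-- Every real flow can be rounded to an integral flow. -/
theorem exists_rounded_flow {f : E → ℝ} (hf : G.boundary ℝ f = 0) :
    ∃ g : E → ℤ, G.boundary ℤ g = 0 ∧ ∀ e, ⌊f e⌋ ≤ g e ∧ g e ≤ ⌈f e⌉ := by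
  classical
  induction hk : (Finset.univ.filter fun e => ¬ ∃ n : ℤ, (n : ℝ) = f e).card using
    Nat.strong_induction_on generalizing f with
  | _ k ih =>
  set D := Finset.univ.filter fun e => ¬ ∃ n : ℤ, (n : ℝ) = f e with hDdef
  have hD : ∀ e, e ∉ D ↔ ∃ n : ℤ, (n : ℝ) = f e := fun e => by simp [hDdef]
  rcases D.eq_empty_or_nonempty with h0 | hne
  · have hint : ∀ e, ∃ n : ℤ, (n : ℝ) = f e := fun e => (hD e).1 (by simp [h0])
    choose g hg using hint
    refine ⟨g, ?_, fun e => ?_⟩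
    · ext w
      have := G.boundary_intCast g w
      simp only [hg] at this
      rw [hf, Pi.zero_apply] at this
      rw [Pi.zero_apply]
      exact_mod_cast this.symm
    · rw [← hg e]; simp
  · obtain ⟨c, hc0, hcf, hcD⟩ := G.exists_flow_on_fractional hf hD hne
    -- the time at which `f + t c` meets the next integer on the edge `e`
    set τ : E → ℝ := fun e =>
      if 0 < c e then (⌈f e⌉ - f e) / c e else (⌊f e⌋ - f e) / c e with hτ
    have hfrac : ∀ e, c e ≠ 0 → (⌊f e⌋ : ℝ) < f e ∧ f e < ⌈f e⌉ := by
      intro e he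
      have hno : ¬ ∃ n : ℤ, (n : ℝ) = f e := fun h => he (hcD e ((hD e).2 h))
      exact ⟨lt_of_le_of_ne (Int.floor_le _) fun h => hno ⟨_, h⟩,
        lt_of_le_of_ne (Int.le_ceil _) fun h => hno ⟨_, h.symm⟩⟩
    obtain ⟨e₀, he₀⟩ : ∃ e, c e ≠ 0 := by
      by_contra h
      push Not at h
      exact hc0 (funext h)
    obtain ⟨m, hm, hmin⟩ := Finset.exists_min_image (Finset.univ.filter fun e => c e ≠ 0) τ
      ⟨e₀, by simpa using he₀⟩
    have hm : c m ≠ 0 := by simpa using hm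
    have hτpos : ∀ e, c e ≠ 0 → 0 < τ e := by
      intro e he
      have := hfrac e he
      simp only [hτ]
      split_ifs with h
      · exact div_pos (by linarith) h
      · exact div_pos_of_neg_of_neg (by linarith) (lt_of_le_of_ne (not_lt.1 h) he)
    have hτm := hτpos m hm
    set f' : E → ℝ := f + τ m • c with hf'
    have hf'e : ∀ e, f' e = f e + τ m * c e := fun e => rfl
    have hbd : ∀ e, (⌊f e⌋ : ℝ) ≤ f' e ∧ f' e ≤ ⌈f e⌉ := by
      intro e
      by_cases he : c e = 0
      · rw [hf'e, he, mul_zero, add_zero]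
        exact ⟨Int.floor_le _, Int.le_ceil _⟩
      · have h1 := hmin e (by simpa using he)
        have h2 := hfrac e he
        rw [hf'e]
        simp only [hτ] at h1 hτm
        by_cases hpos : 0 < c e
        · have h3 : τ m * c e ≤ ⌈f e⌉ - f e := by
            rw [← le_div_iff₀ hpos]
            simp only [hτ]
            rw [if_pos hpos] at h1
            exact h1
          have : 0 < τ m * c e := mul_pos (hτpos m hm) hpos
          constructor <;> linarith
        · have hneg : c e < 0 := lt_of_le_of_ne (not_lt.1 hpos) he
          have h3 : ⌊f e⌋ - f e ≤ τ m * c e := by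
            rw [← le_div_iff_of_neg hneg]
            simp only [hτ]
            rw [if_neg hpos] at h1
            exact h1
          have : τ m * c e < 0 := mul_neg_of_pos_of_neg (hτpos m hm) hneg
          constructor <;> linarith
    have hm' : ∃ n : ℤ, (n : ℝ) = f' m := by
      rw [hf'e]
      simp only [hτ]
      split_ifs with h
      · exact ⟨⌈f m⌉, by field_simp; ring⟩
      · exact ⟨⌊f m⌋, by field_simp; ring⟩
    have hlt : (Finset.univ.filter fun e => ¬ ∃ n : ℤ, (n : ℝ) = f' e).card < k := by
      rw [← hk]
      apply Finset.card_lt_card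
      rw [Finset.ssubset_iff_of_subset]
      · refine ⟨m, ?_, by simpa using hm'⟩
        by_contra h
        exact hm (hcD m h)
      · intro e he
        by_contra h
        have h1 := (hD e).1 h
        have h2 : f' e = f e := by rw [hf'e, hcD e h, mul_zero, add_zero]
        rw [Finset.mem_filter, h2] at he
        exact he.2 h1
    obtain ⟨g, hg, hgb⟩ := ih _ hlt (f := f')
      (by rw [hf', map_add, map_smul, hf, hcf, smul_zero, add_zero]) rfl
    exact ⟨g, hg, fun e => ⟨(Int.le_floor.2 (hbd e).1).trans (hgb e).1,
      (hgb e).2.trans (Int.ceil_le.2 (hbd e).2)⟩⟩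

end Rounding

end DirMultigraph

/-! ### Spanning forests and the matrix of their fundamental cycles -/

namespace DirMultigraph

variable {V : Type u} {E : Type v} (G : DirMultigraph V E)

theorem IsWalk.append {G : DirMultigraph V E} {u v w : V} {l₁ l₂ : List (E × Bool)}
    (h₁ : G.IsWalk u v l₁) (h₂ : G.IsWalk v w l₂) : G.IsWalk u w (l₁ ++ l₂) := by
  induction l₁ generalizing u with
  | nil => obtain rfl : u = v := h₁; exact h₂
  | cons s l ih => exact ⟨h₁.1, ih h₁.2⟩

theorem IsWalk.of_append {G : DirMultigraph V E} {u w : V} {l₁ l₂ : List (E × Bool)}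
    (h : G.IsWalk u w (l₁ ++ l₂)) : ∃ v, G.IsWalk u v l₁ ∧ G.IsWalk v w l₂ := by
  induction l₁ generalizing u with
  | nil => exact ⟨u, rfl, h⟩
  | cons s l ih =>
    obtain ⟨v, h1, h2⟩ := ih h.2
    exact ⟨v, ⟨h.1, h1⟩, h2⟩

/-- The step in the opposite direction. -/
def flipStep (s : E × Bool) : E × Bool := (s.1, !s.2)

theorem tgt_flipStep (s : E × Bool) : G.tgt (flipStep s) = G.src s := by
  rcases s with ⟨e, _ | _⟩ <;> rfl

theorem src_flipStep (s : E × Bool) : G.src (flipStep s) = G.tgt s := by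
  rcases s with ⟨e, _ | _⟩ <;> rfl

theorem IsWalk.reverse {G : DirMultigraph V E} {u w : V} {l : List (E × Bool)}
    (h : G.IsWalk u w l) : G.IsWalk w u (l.reverse.map flipStep) := by
  induction l generalizing u with
  | nil => exact Eq.symm h
  | cons s l ih =>
    rw [List.reverse_cons, List.map_append]
    refine (ih h.2).append ⟨G.src_flipStep s, ?_⟩
    rw [tgt_flipStep]
    exact h.1

theorem IsWalk.map_src_append {G : DirMultigraph V E} {u w : V} {l : List (E × Bool)}
    (h : G.IsWalk u w l) : l.map G.src ++ [w] = u :: l.map G.tgt := by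
  induction l generalizing u with
  | nil => rw [show u = w from h]; rfl
  | cons s l ih =>
    rw [List.map_cons, List.cons_append, ih h.2, h.1, List.map_cons]

theorem IsPathIn.reverse {G : DirMultigraph V E} {T : Finset E} {u w : V} {l : List (E × Bool)}
    (h : G.IsPathIn T u w l) : G.IsPathIn T w u (l.reverse.map flipStep) := by
  obtain ⟨h1, h2, h3⟩ := h
  refine ⟨h1.reverse, fun s hs => ?_, ?_⟩
  · obtain ⟨s', hs', rfl⟩ := List.mem_map.1 hs
    exact h2 s' (List.mem_reverse.1 hs')
  · rw [← h1.map_src_append, ← List.nodup_reverse, List.reverse_append] at h3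
    rw [List.map_map, show G.tgt ∘ flipStep = G.src from funext G.tgt_flipStep, List.map_reverse]
    simpa using h3

/-- A nonzero flow supported on a set `T` of edges yields a cycle in `T`: by conservation, a walk in
its support can always be continued along a new edge, until it meets a vertex again. -/
theorem CycleFree.flow_eq_zero [Fintype V] [Fintype E] {G : DirMultigraph V E} {T : Finset E}
    (hT : G.CycleFree T) {f : E → ℝ} (hf : G.boundary ℝ f = 0) (hfT : ∀ e ∉ T, f e = 0) :
    f = 0 := by
  classical
  by_contra hne
  have hmemT : ∀ e, f e ≠ 0 → e ∈ T := fun e he => by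
    by_contra h
    exact he (hfT e h)
  have hloop : ∀ e, f e ≠ 0 → G.head e ≠ G.tail e := by
    intro e he h
    refine hT (G.tail e) [(e, true)] ⟨by simp, ⟨rfl, ?_⟩, ?_, by simp, by simp⟩
    · exact h
    · simpa using hmemT e he
  have hnext : ∀ s : {s : E × Bool // f s.1 ≠ 0}, ∃ s' : {s : E × Bool // f s.1 ≠ 0},
      G.src s'.1 = G.tgt s.1 ∧ s'.1.1 ≠ s.1.1 := by
    rintro ⟨s, hs⟩
    by_contra hno
    push Not at hno
    have h1 : ∀ e, e ≠ s.1 → f e ≠ 0 → ¬ G.tgt s = G.head e ∧ ¬ G.tgt s = G.tail e :=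
      fun e he hfe => ⟨fun h => he (hno ⟨(e, false), hfe⟩ h.symm),
        fun h => he (hno ⟨(e, true), hfe⟩ h.symm)⟩
    have h0 : G.boundary ℝ f (G.tgt s) = 0 := by rw [hf]; rfl
    rw [boundary_apply, Finset.sum_eq_single s.1] at h0
    · have h2 := hloop s.1 hs
      rcases s with ⟨e, _ | _⟩
      · have h3 : G.tgt (e, false) = G.tail e := rfl
        rw [h3, if_neg h2.symm, if_pos rfl] at h0
        exact hs (by linarith)
      · have h3 : G.tgt (e, true) = G.head e := rfl
        rw [h3, if_neg h2, if_pos rfl] at h0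
        exact hs (by linarith)
    · intro e _ he
      by_cases hfe : f e = 0
      · rw [hfe, zero_mul]
      · rw [if_neg (h1 e he hfe).1, if_neg (h1 e he hfe).2]; ring
    · simp
  choose nxt hnsrc hnedge using hnext
  obtain ⟨e₀, he₀⟩ : ∃ e, f e ≠ 0 := by
    by_contra h
    push Not at h
    exact hne (funext h)
  let q : ℕ → {s : E × Bool // f s.1 ≠ 0} := fun n => nxt^[n] ⟨(e₀, true), he₀⟩
  have hq : ∀ n, q (n + 1) = nxt (q n) := fun n => Function.iterate_succ_apply' _ _ _
  let x : ℕ → V := fun n => G.src (q n).1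
  have hx : ∀ n, G.tgt (q n).1 = x (n + 1) := fun n => by
    simp only [x]; rw [hq, hnsrc]
  have hrep : ∃ j, ∃ i < j, x i = x j := by
    obtain ⟨a, b, hab, h⟩ := Finite.exists_ne_map_eq_of_infinite x
    rcases lt_or_gt_of_ne hab with h' | h'
    · exact ⟨b, a, h', h⟩
    · exact ⟨a, b, h', h.symm⟩
  set j := Nat.find hrep with hj
  obtain ⟨i, hij, hxij⟩ := Nat.find_spec hrep
  rw [← hj] at hij hxij
  have hinj : ∀ a < j, ∀ b < j, x a = x b → a = b := by
    intro a ha b hb h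
    by_contra hab
    rcases lt_or_gt_of_ne hab with h' | h'
    · exact Nat.find_min hrep hb ⟨a, h', h⟩
    · exact Nat.find_min hrep ha ⟨b, h', h.symm⟩
  have hwalk : ∀ m i, G.IsWalk (x i) (x (i + m)) ((List.range' i m).map fun n => (q n).1) := by
    intro m
    induction m with
    | zero => intro i; exact rfl
    | succ m ih =>
      intro i
      rw [List.range'_succ, List.map_cons]
      refine ⟨rfl, ?_⟩
      rw [hx]
      have := ih (i + 1)
      rwa [show i + 1 + m = i + (m + 1) by ring] at this
  have hedge : ∀ a b, a < b → b < j → (q a).1.1 ≠ (q b).1.1 := by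
    intro a b hab hb h
    by_cases hbool : (q a).1.2 = (q b).1.2
    · have : (q a).1 = (q b).1 := Prod.ext h hbool
      have : x a = x b := by simp only [x, this]
      have := hinj a (by omega) b hb this
      omega
    · have h1 : (q b).1 = flipStep (q a).1 := by
        refine Prod.ext h.symm ?_
        simp only [flipStep]
        revert hbool
        cases (q a).1.2 <;> cases (q b).1.2 <;> simp
      have h2 : x (a + 1) = x b := by
        rw [← hx]; simp only [x]; rw [h1, src_flipStep]
      have h3 := hinj (a + 1) (by omega) b hb h2
      subst h3
      rw [hq] at h
      exact hnedge _ h.symm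
  refine hT (x i) ((List.range' i (j - i)).map fun n => (q n).1) ⟨?_, ?_, ?_, ?_, ?_⟩
  · intro h
    have := congrArg List.length h
    simp at this
    omega
  · have := hwalk (j - i) i
    rwa [show i + (j - i) = j by omega, ← hxij] at this
  · intro s hs
    obtain ⟨n, -, rfl⟩ := List.mem_map.1 hs
    exact hmemT _ (q n).2
  · rw [List.map_map]
    refine List.Nodup.map_on ?_ List.nodup_range'
    intro a ha b hb h
    simp only [Function.comp_apply, hx] at h
    rw [List.mem_range'_1] at ha hb
    rcases (show a + 1 ≤ j by omega).eq_or_lt with h1 | h1 <;>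
      rcases (show b + 1 ≤ j by omega).eq_or_lt with h2 | h2
    · omega
    · rw [h1, ← hxij] at h
      have := hinj i hij (b + 1) h2 h
      omega
    · rw [h2, ← hxij] at h
      have := hinj (a + 1) h1 i hij h
      omega
    · have := hinj (a + 1) h1 (b + 1) h2 h
      omega
  · rw [List.map_map]
    refine List.Nodup.map_on ?_ List.nodup_range'
    intro a ha b hb h
    rw [List.mem_range'_1] at ha hb
    by_contra hab
    rcases lt_or_gt_of_ne hab with h' | h'
    · exact hedge a b h' (by omega) h
    · exact hedge b a h' (by omega) h.symm

/-- The ends of an edge outside a spanning forest are joined by a path in the forest: the remainder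
of the cycle that appears when the edge is added. -/
theorem IsSpanningForest.exists_path {G : DirMultigraph V E} {T : Finset E}
    (hT : G.IsSpanningForest T) {e : E} (he : e ∉ T) :
    ∃ l, G.IsPathIn T (G.head e) (G.tail e) l := by
  classical
  have hnot : ¬ G.CycleFree (insert e T) := fun h =>
    he (hT.2 h (Finset.subset_insert e T) (Finset.mem_insert_self e T))
  unfold CycleFree at hnot
  push Not at hnot
  obtain ⟨u, l, hl0, hwalk, hmem, hn1, hn2⟩ := hnot
  have hex : ∃ s ∈ l, s.1 = e := by
    by_contra hno
    push Not at hno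
    exact hT.1 u l ⟨hl0, hwalk, fun s hs =>
      (Finset.mem_insert.1 (hmem s hs)).resolve_left (hno s hs), hn1, hn2⟩
  obtain ⟨s, hs, rfl⟩ := hex
  obtain ⟨l₁, l₂, rfl⟩ := List.append_of_mem hs
  obtain ⟨w, h1, h2⟩ := hwalk.of_append
  obtain ⟨rfl, h2⟩ := h2
  have hperm : (l₁ ++ s :: l₂).Perm (s :: (l₂ ++ l₁)) :=
    List.perm_middle.trans (List.Perm.cons s List.perm_append_comm)
  have hn1' : (G.tgt s :: (l₂ ++ l₁).map G.tgt).Nodup := by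
    rw [← List.map_cons]; exact (hperm.map G.tgt).nodup_iff.1 hn1
  have hn2' : (s.1 :: (l₂ ++ l₁).map Prod.fst).Nodup := by
    rw [← List.map_cons (f := Prod.fst)]; exact (hperm.map Prod.fst).nodup_iff.1 hn2
  have hpath : G.IsPathIn T (G.tgt s) (G.src s) (l₂ ++ l₁) := by
    refine ⟨h2.append h1, fun s' hs' => ?_, hn1'⟩
    have hs'' := hmem s' (hperm.mem_iff.2 (List.mem_cons_of_mem _ hs'))
    refine (Finset.mem_insert.1 hs'').resolve_left fun h => (List.nodup_cons.1 hn2').1 ?_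
    rw [← h]
    exact List.mem_map_of_mem hs'
  rcases s with ⟨e, _ | _⟩
  · exact ⟨_, hpath.reverse⟩
  · exact ⟨_, hpath⟩

/-- The fundamental cycles of a spanning forest: the column of `e ∉ T` is the sign vector of `e`
followed by the path in `T` from the head of `e` to its tail. -/
noncomputable def cycleMatrix {G : DirMultigraph V E} {T : Finset E} (hT : G.IsSpanningForest T)
    (e : E) (e' : {e // e ∉ T}) : ℤ := open Classical in
  (Pi.single e'.1 1 + chain ℤ (hT.exists_path e'.2).choose : E → ℤ) e

section CycleMatrix

variable {G} {T : Finset E}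

theorem cycleMatrix_of_notMem [DecidableEq E] (hT : G.IsSpanningForest T) (e : {e // e ∉ T}) :
    cycleMatrix hT e.1 = Pi.single e 1 := by
  ext e'
  have h : chain ℤ (hT.exists_path e'.2).choose e.1 = 0 := chain_eq_zero _ fun s hs h =>
    e.2 (h ▸ (hT.exists_path e'.2).choose_spec.2.1 s hs)
  rw [cycleMatrix, Pi.add_apply, h, add_zero]
  by_cases he : e = e'
  · subst he; simp
  · have : e.1 ≠ e'.1 := fun h => he (Subtype.ext h)
    simp [this, Ne.symm he]

variable [Fintype E]

theorem boundary_cycleMatrix (hT : G.IsSpanningForest T) (e' : {e // e ∉ T}) :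
    G.boundary ℤ (fun e => cycleMatrix hT e e') = 0 := by
  classical
  have : (fun e => cycleMatrix hT e e') =
      Pi.single e'.1 1 + chain ℤ (hT.exists_path e'.2).choose := by
    ext e
    simp only [cycleMatrix, Pi.add_apply, Pi.single_apply]
  rw [this, map_add, boundary_chain G ℤ (hT.exists_path e'.2).choose_spec.1, boundary_single]
  abel

theorem boundary_realValue_cycleMatrix (hT : G.IsSpanningForest T) [Fintype {e // e ∉ T}]
    (x : {e // e ∉ T} → ℝ) :
    G.boundary ℝ (fun e => LatticeCone.realValue (cycleMatrix hT e) x) = 0 := by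
  have : (fun e => LatticeCone.realValue (cycleMatrix hT e) x) =
      ∑ e', x e' • fun e => (cycleMatrix hT e e' : ℝ) := by
    ext e
    simp [LatticeCone.realValue, mul_comm]
  rw [this, map_sum]
  refine Finset.sum_eq_zero fun e' _ => ?_
  rw [map_smul]
  have : G.boundary ℝ (fun e => (cycleMatrix hT e e' : ℝ)) = 0 := by
    ext w
    rw [boundary_intCast, boundary_cycleMatrix]
    simp
  rw [this, smul_zero]

variable [Fintype V]

/-- A flow is determined by its values outside a spanning forest. -/
theorem flow_eq_of_eqOn_compl (hT : G.IsSpanningForest T) {f f' : E → ℝ} (hf : G.boundary ℝ f = 0)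
    (hf' : G.boundary ℝ f' = 0) (h : ∀ e ∉ T, f e = f' e) : f = f' := by
  refine sub_eq_zero.1 (hT.1.flow_eq_zero (f := f - f') (by rw [map_sub, hf, hf', sub_zero]) ?_)
  intro e he
  rw [Pi.sub_apply, h e he, sub_self]

theorem forestMatrix_eq (hT : G.IsSpanningForest T) (t : {e // e ∈ T}) (e : {e // e ∉ T}) :
    G.forestMatrix T t e = cycleMatrix hT t e := by
  classical
  set l₀ := (hT.exists_path e.2).choose with hl₀
  have h₀ : G.IsPathIn T (G.head e) (G.tail e) l₀ := (hT.exists_path e.2).choose_spec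
  -- all paths in the forest with the same ends have the same sign vector
  have huniq : ∀ l, G.IsPathIn T (G.head e) (G.tail e) l → chain ℤ l t = chain ℤ l₀ t := by
    intro l hl
    have key : ∀ l, G.IsPathIn T (G.head e) (G.tail e) l →
        G.boundary ℝ (fun e => (chain ℤ l e : ℝ)) =
          (fun w => ((Pi.single (G.tail e) 1 - Pi.single (G.head e) 1 : V → ℤ) w : ℝ)) ∧
        ∀ e' ∉ T, (chain ℤ l e' : ℝ) = 0 := by
      intro l hl
      constructor
      · ext w
        rw [boundary_intCast, boundary_chain G ℤ hl.1]
      · intro e' he'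
        rw [chain_eq_zero ℤ (e := e') fun s hs h => he' (h ▸ hl.2.1 s hs), Int.cast_zero]
    have h1 := hT.1.flow_eq_zero
      (f := (fun e => (chain ℤ l e : ℝ)) - fun e => (chain ℤ l₀ e : ℝ))
      (by rw [map_sub, (key l hl).1, (key l₀ h₀).1, sub_self])
      (fun e' he' => by
        rw [Pi.sub_apply, (key l hl).2 e' he', (key l₀ h₀).2 e' he', sub_self])
    have h2 := congrFun h1 t
    rw [Pi.sub_apply, Pi.zero_apply, sub_eq_zero] at h2
    exact_mod_cast h2
  have hval : cycleMatrix hT t e = chain ℤ l₀ t := by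
    have hne : t.1 ≠ e.1 := fun h => e.2 (h ▸ t.2)
    rw [cycleMatrix, Pi.add_apply, Pi.single_eq_of_ne hne, zero_add]
  rw [hval, forestMatrix]
  split_ifs with h1 h2
  · obtain ⟨l, hl, hlt⟩ := h1
    rw [← huniq l hl, chain_of_nodup G hl.1 hl.2.2, if_pos hlt, Int.cast_one]
  · obtain ⟨l, hl, hlt⟩ := h2
    rw [← huniq l hl, chain_of_nodup G hl.1 hl.2.2, if_neg fun h => h1 ⟨l, hl, h⟩, if_pos hlt]
    simp
  · rw [chain_of_nodup G h₀.1 h₀.2.2, if_neg fun h => h1 ⟨l₀, h₀, h⟩,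
      if_neg fun h => h2 ⟨l₀, h₀, h⟩, Int.cast_zero]

theorem exists_rounding_cycleMatrix (hT : G.IsSpanningForest T) [Fintype {e // e ∉ T}]
    (x : {e // e ∉ T} → ℝ) :
    ∃ z : {e // e ∉ T} → ℤ, ∀ e, ⌊LatticeCone.realValue (cycleMatrix hT e) x⌋ ≤
        cycleMatrix hT e ⬝ᵥ z ∧
      cycleMatrix hT e ⬝ᵥ z ≤ ⌈LatticeCone.realValue (cycleMatrix hT e) x⌉ := by
  classical
  obtain ⟨g, hg, hgb⟩ := G.exists_rounded_flow (boundary_realValue_cycleMatrix hT x)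
  refine ⟨fun e => g e, fun e => ?_⟩
  have h1 : (fun e => LatticeCone.realValue (cycleMatrix hT e)
      (fun e' : {e // e ∉ T} => (g e' : ℝ))) = fun e => (g e : ℝ) := by
    refine flow_eq_of_eqOn_compl hT (boundary_realValue_cycleMatrix hT _) ?_ fun e he => ?_
    · ext w
      rw [boundary_intCast, hg]
      simp
    · have := cycleMatrix_of_notMem hT ⟨e, he⟩
      simp only at this
      rw [this, LatticeCone.realValue, Finset.sum_eq_single ⟨e, he⟩]
      · simp
      · intro b _ hb; simp [hb]
      · simp
  have h2 : cycleMatrix hT e ⬝ᵥ (fun e' : {e // e ∉ T} => g e') = g e := by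
    have h3 := congrFun h1 e
    have h4 := LatticeCone.realValue_intCast (cycleMatrix hT e)
      (fun e' : {e // e ∉ T} => g e')
    rw [h4] at h3
    exact_mod_cast h3
  rw [h2]
  exact hgb e

/-- The number of edges outside a spanning forest of a connected graph is the dimension of the space
of flows, which the rank of the boundary operator determines. -/
theorem card_compl_forest (hT : G.IsSpanningForest T) (hG : G.Connected) [Fintype {e // e ∉ T}] :
    Fintype.card {e // e ∉ T} + Fintype.card V = Fintype.card E + 1 := by
  classical
  have hker : Module.finrank ℝ (LinearMap.ker (G.boundary ℝ)) = Fintype.card {e // e ∉ T} := by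
    rw [← Module.finrank_fintype_fun_eq_card (R := ℝ)]
    let ρ : LinearMap.ker (G.boundary ℝ) →ₗ[ℝ] ({e // e ∉ T} → ℝ) :=
      (LinearMap.pi fun e => LinearMap.proj e.1).comp (Submodule.subtype _)
    refine (LinearEquiv.ofBijective ρ ⟨?_, ?_⟩).finrank_eq
    · intro f f' h
      exact Subtype.ext (flow_eq_of_eqOn_compl hT f.2 f'.2 fun e he => congrFun h ⟨e, he⟩)
    · intro x
      refine ⟨⟨_, LinearMap.mem_ker.2 (boundary_realValue_cycleMatrix hT x)⟩, ?_⟩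
      ext e
      change LatticeCone.realValue (cycleMatrix hT e.1) x = x e
      rw [cycleMatrix_of_notMem, LatticeCone.realValue, Finset.sum_eq_single e]
      · simp
      · intro b _ hb; simp [hb]
      · simp
  obtain ⟨⟨v₀⟩, hconn⟩ := hG
  let σ : (V → ℝ) →ₗ[ℝ] ℝ := ∑ w, LinearMap.proj w
  have hσ : ∀ g, σ g = ∑ w, g w := fun g => by simp [σ]
  have hrange : LinearMap.range (G.boundary ℝ) = LinearMap.ker σ := by
    apply le_antisymm
    · rintro _ ⟨f, rfl⟩
      rw [LinearMap.mem_ker, hσ, sum_boundary]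
    · intro g hg
      rw [LinearMap.mem_ker, hσ] at hg
      have hsum : g = ∑ w, g w • (Pi.single w 1 - Pi.single v₀ 1 : V → ℝ) := by
        simp only [smul_sub, Finset.sum_sub_distrib, ← Finset.sum_smul, hg, zero_smul, sub_zero]
        ext w
        simp [Pi.single_apply]
      rw [hsum]
      refine Submodule.sum_mem _ fun w _ => Submodule.smul_mem _ _ ?_
      obtain ⟨l, hl⟩ := hconn v₀ w
      refine ⟨chain ℝ l, ?_⟩
      rw [boundary_chain G ℝ hl]
  have h1 := LinearMap.finrank_range_add_finrank_ker (G.boundary ℝ)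
  have h2 := LinearMap.finrank_range_add_finrank_ker σ
  have h3 : LinearMap.range σ = ⊤ := by
    rw [LinearMap.range_eq_top]
    intro a
    exact ⟨Pi.single v₀ a, by rw [hσ]; simp⟩
  rw [h3, finrank_top, Module.finrank_self, Module.finrank_fintype_fun_eq_card] at h2
  rw [hrange, hker, Module.finrank_fintype_fun_eq_card] at h1
  omega

end CycleMatrix

end DirMultigraph

/-! ### Ehrhart polynomials and `h*`-vectors from numerators -/

namespace LatticeCone

theorem map_mk_one (S : Type*) [CommRing S] :
    PowerSeries.map (Nat.castRingHom S) (PowerSeries.mk 1) = PowerSeries.mk 1 := by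
  ext; simp

theorem ascPochhammer_eval_neg_natCast {n m : ℕ} (h : m < n) :
    (ascPochhammer ℚ n).eval (-(m : ℚ)) = 0 := by
  induction n with
  | zero => omega
  | succ n ih =>
    rw [ascPochhammer_succ_eval]
    rcases (Nat.lt_succ_iff.1 h).eq_or_lt with rfl | h
    · simp
    · rw [ih h, zero_mul]

theorem preHilbertPoly_eval_of_lt {d i k : ℕ} (hi : i ≤ d) (hk : k < i) :
    (preHilbertPoly ℚ d i).eval (k : ℚ) = 0 := by
  have h : (k : ℚ) - i + 1 = -((i - k - 1 : ℕ) : ℚ) := by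
    obtain ⟨m, rfl⟩ := Nat.exists_eq_add_of_lt hk
    have : k + m + 1 - k - 1 = m := by omega
    rw [this]; push_cast; ring
  rw [preHilbertPoly, eval_smul, eval_comp, eval_add, eval_sub, eval_X, eval_C, eval_one, h,
    ascPochhammer_eval_neg_natCast (by omega), smul_zero]

/-- If the numerator of `h / (1 - t) ^ (r + 1)` has degree at most `r`, then the coefficients of
this series are the values of a polynomial at all natural numbers (zero included), and the degree
is exactly `r` because the coefficients of `h` are nonnegative and not all zero. -/
theorem exists_polynomial {r : ℕ} {h : PowerSeries ℕ} (hr : ∀ i, r < i → PowerSeries.coeff i h = 0)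
    (h0 : PowerSeries.coeff 0 h ≠ 0) :
    ∃ L : ℚ[X], L.natDegree = r ∧
      ∀ k : ℕ, L.eval (k : ℚ) = (PowerSeries.coeff k (h * PowerSeries.mk 1 ^ (r + 1)) : ℕ) := by
  set L : ℚ[X] :=
    ∑ i ∈ Finset.range (r + 1), ((PowerSeries.coeff i h : ℕ) : ℚ) • preHilbertPoly ℚ r i
    with hL
  refine ⟨L, ?_, fun k => ?_⟩
  · apply natDegree_eq_of_le_of_coeff_ne_zero
    · refine natDegree_sum_le_of_forall_le _ _ fun i _ => ?_
      exact (natDegree_smul_le _ _).trans (natDegree_preHilbertPoly ℚ r i).le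
    · have : L.coeff r = (∑ i ∈ Finset.range (r + 1), ((PowerSeries.coeff i h : ℕ) : ℚ)) *
          (r.factorial : ℚ)⁻¹ := by
        rw [hL, finsetSum_coeff, Finset.sum_mul]
        exact Finset.sum_congr rfl fun i _ => by
          rw [coeff_smul, coeff_preHilbertPoly_self, smul_eq_mul]
      rw [this]
      refine mul_ne_zero (ne_of_gt ?_) (by positivity)
      refine lt_of_lt_of_le (b := ((PowerSeries.coeff 0 h : ℕ) : ℚ)) (by positivity) ?_
      exact Finset.single_le_sum (f := fun i => ((PowerSeries.coeff i h : ℕ) : ℚ))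
        (fun _ _ => by positivity) (Finset.mem_range.2 (Nat.succ_pos r))
  · have h1 : ((PowerSeries.coeff k (h * PowerSeries.mk 1 ^ (r + 1)) : ℕ) : ℚ) =
        PowerSeries.coeff k (PowerSeries.map (Nat.castRingHom ℚ) h *
          PowerSeries.mk fun n => (((r + n).choose r : ℕ) : ℚ)) := by
      rw [← PowerSeries.mk_one_pow_eq_mk_choose_add, ← map_mk_one, ← map_pow, ← map_mul,
        PowerSeries.coeff_map]
      rfl
    rw [h1, PowerSeries.coeff_mul,
      Finset.Nat.sum_antidiagonal_eq_sum_range_succ (fun i j =>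
        PowerSeries.coeff i (PowerSeries.map (Nat.castRingHom ℚ) h) *
        PowerSeries.coeff j (PowerSeries.mk fun n => (((r + n).choose r : ℕ) : ℚ))), hL,
      eval_finsetSum]
    have h2 : Finset.range (r + 1) ⊆ Finset.range (r + k + 1) := by
      intro i; simp only [Finset.mem_range]; omega
    have h3 : Finset.range k.succ ⊆ Finset.range (r + k + 1) := by
      intro i; simp only [Finset.mem_range]; omega
    have h4 : ∑ i ∈ Finset.range (r + 1),
        eval (k : ℚ) (((PowerSeries.coeff i h : ℕ) : ℚ) • preHilbertPoly ℚ r i) =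
        ∑ i ∈ Finset.range (r + 1), if i ≤ k then
          ((PowerSeries.coeff i h : ℕ) : ℚ) * ((r + (k - i)).choose r : ℕ) else 0 := by
      refine Finset.sum_congr rfl fun i hi => ?_
      rw [eval_smul, smul_eq_mul]
      split_ifs with hik
      · rw [preHilbertPoly_eq_choose_sub_add ℚ r hik, add_comm r]
      · rw [preHilbertPoly_eval_of_lt (by simpa [Nat.lt_succ_iff] using hi) (by omega), mul_zero]
    rw [h4, Finset.sum_subset h2, ← Finset.sum_subset h3]
    · refine Finset.sum_congr rfl fun i hi => ?_
      rw [if_pos (by simpa [Nat.lt_succ_iff] using hi)]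
      simp
    · intro i _ hi
      rw [if_neg (by simpa [Nat.lt_succ_iff] using hi)]
    · intro i _ hi
      rw [hr i (by simpa [Nat.lt_succ_iff] using hi)]
      simp

theorem hStar_eq_coeff {r : ℕ} {h : PowerSeries ℕ} {L : ℚ[X]} (hd : L.natDegree = r)
    (hL : ∀ k : ℕ, L.eval (k : ℚ) = (PowerSeries.coeff k (h * PowerSeries.mk 1 ^ (r + 1)) : ℕ))
    (i : ℕ) : hStar L i = (PowerSeries.coeff i h : ℕ) := by
  have h1 : (PowerSeries.mk fun k : ℕ => L.eval (k : ℚ)) =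
      PowerSeries.map (Nat.castRingHom ℚ) (h * PowerSeries.mk 1 ^ (r + 1)) := by
    ext k
    rw [PowerSeries.coeff_mk, hL, PowerSeries.coeff_map]
    rfl
  rw [hStar, hd, h1, map_mul (PowerSeries.map _), map_pow (PowerSeries.map _), map_mk_one,
    mul_left_comm, ← mul_pow,
    mul_comm (1 - PowerSeries.X), PowerSeries.mk_one_mul_one_sub_eq_one, one_pow, mul_one]
  simp

theorem natDegree_two_mul_X_add_one_pow (r : ℕ) : ((2 * X + 1 : ℚ[X]) ^ r).natDegree = r := by
  have : (2 * X + 1 : ℚ[X]).natDegree = 1 := by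
    have : (2 * X + 1 : ℚ[X]) = C 2 * X + C 1 := by rw [map_ofNat, map_one]
    rw [this, natDegree_linear (by norm_num)]
  rw [natDegree_pow, this, mul_one]

theorem coeff_one_sub_X_pow (n m : ℕ) :
    PowerSeries.coeff m ((1 - PowerSeries.X : PowerSeries ℚ) ^ n) =
      (-1) ^ m * (n.choose m : ℚ) := by
  have h1 : (1 - PowerSeries.X : PowerSeries ℚ) ^ n =
      ∑ j ∈ Finset.range (n + 1),
        PowerSeries.C ((-1) ^ j * (n.choose j : ℚ)) * PowerSeries.X ^ j := by
    rw [sub_eq_neg_add, add_pow]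
    refine Finset.sum_congr rfl fun j _ => ?_
    rw [one_pow, mul_one, neg_pow, map_mul, map_pow, map_neg, map_one, map_natCast]
    ring
  rw [h1, map_sum]
  simp only [PowerSeries.coeff_C_mul, PowerSeries.coeff_X_pow, mul_ite, mul_one, mul_zero]
  rw [Finset.sum_ite_eq]
  split_ifs with h
  · rfl
  · rw [Nat.choose_eq_zero_of_lt (by simpa [Nat.lt_succ_iff] using h)]; simp

theorem hStar_cube (r i : ℕ) :
    hStar ((2 * X + 1) ^ r) i = (macMahon (r + 1) (i + 1) : ℚ) := by
  rw [hStar, natDegree_two_mul_X_add_one_pow, mul_comm, PowerSeries.coeff_mul,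
    Finset.Nat.sum_antidiagonal_eq_sum_range_succ (fun a b =>
      PowerSeries.coeff a (PowerSeries.mk fun k : ℕ => ((2 * X + 1 : ℚ[X]) ^ r).eval (k : ℚ)) *
      PowerSeries.coeff b ((1 - PowerSeries.X : PowerSeries ℚ) ^ (r + 1))), macMahon,
    Int.cast_sum, Finset.range_eq_Ico, Finset.sum_Ico_eq_sum_range]
  have : Finset.Icc 1 (i + 1) = Finset.Ico 1 (i + 2) := by ext j; simp; omega
  rw [this, Finset.sum_Ico_eq_sum_range]
  refine Finset.sum_congr (by congr 1) fun j _ => ?_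
  have e1 : i + 1 - (1 + j) = i - j := by omega
  rw [e1, coeff_one_sub_X_pow, PowerSeries.coeff_mk]
  simp
  ring

/-- The coefficients of the generating function of the cone count the lattice points of the
dilates of the polytope. -/
theorem coeff_of_hasSeries_slabCone {κ : Type*} {r : ℕ} {A : κ → Fin r → ℤ} {S : Set κ}
    {f : PowerSeries ℕ} (hf : HasSeries (Pi.single 0 1) (slabCone A S) f) (k : ℕ) :
    PowerSeries.coeff k f = {z : Fin r → ℤ | ∀ e ∈ S, |A e ⬝ᵥ z| ≤ k}.ncard := by
  have hinj : Function.Injective fun z : Fin r → ℤ => (Fin.cons (k : ℤ) z : Fin (r + 1) → ℤ) :=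
    Fin.cons_right_injective (α := fun _ => ℤ) (k : ℤ)
  rw [← (hf k).2, ← Set.ncard_image_of_injective {z | ∀ e ∈ S, |A e ⬝ᵥ z| ≤ k} hinj]
  congr 1
  ext x
  simp only [slabCone, Set.mem_ofPred_eq, single_dotProduct, one_mul, Set.mem_image]
  constructor
  · rintro ⟨⟨-, h⟩, h0⟩
    exact ⟨Fin.tail x, fun e he => h0 ▸ h e he, by rw [← h0, Fin.cons_self_tail]⟩
  · rintro ⟨z, hz, rfl⟩
    simpa using hz

theorem ncard_cube {ι : Type*} [Fintype ι] (k : ℕ) :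
    {z : ι → ℤ | ∀ i, |z i| ≤ k}.ncard = (2 * k + 1) ^ Fintype.card ι := by
  classical
  have : {z : ι → ℤ | ∀ i, |z i| ≤ k} =
      (Fintype.piFinset fun _ : ι => Finset.Icc (-(k : ℤ)) k : Finset (ι → ℤ)) := by
    ext z
    simp only [Set.mem_ofPred_eq, Finset.mem_coe, Fintype.mem_piFinset, Finset.mem_Icc, abs_le]
  rw [this, Set.ncard_coe_finset, Fintype.card_piFinset]
  simp only [Int.card_Icc, Finset.prod_const, Finset.card_univ]
  congr 1
  omega

end LatticeCone

/-! ### The flow polytope -/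

namespace DirMultigraph

open LatticeCone

theorem mem_smul_flowPolytope {V E : Type*} [Fintype E] [DecidableEq E] (G : DirMultigraph V E)
    (T : Finset E) {k : ℕ} (hk : 0 < k) (x : {e // e ∉ T} → ℝ) :
    x ∈ (k : ℝ) • G.flowPolytope T ↔
      (∀ t, |(G.forestMatrix T *ᵥ x) t| ≤ k) ∧ ∀ e, |x e| ≤ k := by
  have hk' : (0 : ℝ) < k := by exact_mod_cast hk
  have key : ∀ y : ℝ, -1 ≤ (k : ℝ)⁻¹ * y ∧ (k : ℝ)⁻¹ * y ≤ 1 ↔ |y| ≤ k := fun y => by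
    rw [← abs_le, abs_mul, abs_of_pos (inv_pos.2 hk'), inv_mul_le_iff₀ hk', mul_one]
  rw [Set.mem_smul_set_iff_inv_smul_mem₀ hk'.ne']
  simp only [flowPolytope, Set.mem_ofPred_eq, mulVec_smul, Pi.smul_apply, smul_eq_mul,
    ← mul_neg, key, abs_neg]

theorem ehrhart_flowPolytope {V : Type u} {E : Type v} [Fintype V] [Fintype E] [DecidableEq E]
    {G : DirMultigraph V E} {T : Finset E} (hT : G.IsSpanningForest T) {k : ℕ} (hk : 0 < k) :
    ehrhart (G.flowPolytope T) k =
      {z : {e // e ∉ T} → ℤ | ∀ e, |cycleMatrix hT e ⬝ᵥ z| ≤ k}.ncard := by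
  rw [ehrhart]
  congr 1
  ext z
  rw [Set.mem_ofPred_eq, Set.mem_ofPred_eq, mem_smul_flowPolytope G T hk]
  have h1 : ∀ t, (G.forestMatrix T *ᵥ fun i => (z i : ℝ)) t = (cycleMatrix hT t ⬝ᵥ z : ℤ) := by
    intro t
    rw [← realValue_intCast]
    simp only [mulVec, dotProduct, realValue, forestMatrix_eq hT]
  have h2 : ∀ e : {e // e ∉ T}, cycleMatrix hT e ⬝ᵥ z = z e := fun e => by
    classical
    rw [cycleMatrix_of_notMem, single_dotProduct, one_mul]
  simp only [h1]
  constructor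
  · rintro ⟨ht, he⟩ e
    by_cases hmem : e ∈ T
    · exact_mod_cast ht ⟨e, hmem⟩
    · have := he ⟨e, hmem⟩
      rw [← h2] at this
      exact_mod_cast this
  · intro h
    refine ⟨fun t => by exact_mod_cast h t, fun e => ?_⟩
    have := h e
    rw [h2] at this
    exact_mod_cast this

theorem exists_ehrhart_bounds {V : Type u} {E : Type v} [Fintype V] [Fintype E] [DecidableEq E]
    {G : DirMultigraph V E} {T : Finset E} (hT : G.IsSpanningForest T) {r : ℕ}
    (hr : Fintype.card {e // e ∉ T} = r) :
    ∃ L : ℚ[X], IsEhrhartPolynomial L (G.flowPolytope T) ∧ L.natDegree = r ∧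
      ∀ i : ℕ, (r.choose i : ℚ) ≤ hStar L i ∧ hStar L i ≤ hStar ((2 * X + 1) ^ r) i := by
  classical
  let σ : {e // e ∉ T} ≃ Fin r := Fintype.equivFinOfCardEq hr
  -- the edges on which every flow vanishes impose no condition
  let κ := {e : E // cycleMatrix hT e ≠ 0}
  let A : κ → Fin r → ℤ := fun e i => cycleMatrix hT e.1 (σ.symm i)
  have hA : ∀ e, A e ≠ 0 := fun e h => e.2 (by
    ext e'
    have := congrFun h (σ e')
    simpa [A] using this)
  let c : Fin r → κ := fun i => ⟨(σ.symm i).1, by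
    rw [cycleMatrix_of_notMem]
    exact Pi.single_ne_zero_iff.2 one_ne_zero⟩
  have hc : ∀ i, A (c i) = Pi.single i 1 := by
    intro i
    ext j
    simp only [A, c]
    rw [cycleMatrix_of_notMem]
    simp [Pi.single_apply]
  have hdot : ∀ (e : κ) (z : {e // e ∉ T} → ℤ),
      A e ⬝ᵥ (fun i => z (σ.symm i)) = cycleMatrix hT e.1 ⬝ᵥ z := fun e z =>
    Fintype.sum_equiv σ.symm _ _ fun i => rfl
  have hR : HasRounding A := by
    intro x
    obtain ⟨z, hz⟩ := exists_rounding_cycleMatrix hT fun e => x (σ e)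
    refine ⟨fun i => z (σ.symm i), fun e => ?_⟩
    have : realValue (A e) x = realValue (cycleMatrix hT e.1) fun e => x (σ e) :=
      Fintype.sum_equiv σ.symm _ _ fun i => by simp [A]
    rw [hdot, this]
    exact hz e
  obtain ⟨h, hQ, hs, hsQ, hb⟩ := exists_numerator_bounds hA c hc hR
  have hcount : ∀ k : ℕ, {z : Fin r → ℤ | ∀ e ∈ Set.univ, |A e ⬝ᵥ z| ≤ k}.ncard =
      {z : {e // e ∉ T} → ℤ | ∀ e, |cycleMatrix hT e ⬝ᵥ z| ≤ k}.ncard := by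
    intro k
    have hinj : Function.Injective fun (z : {e // e ∉ T} → ℤ) (i : Fin r) => z (σ.symm i) :=
      fun z z' hz => by ext e; simpa using congrFun hz (σ e)
    rw [← Set.ncard_image_of_injective _ hinj]
    congr 1
    ext z
    simp only [Set.mem_ofPred_eq, Set.mem_image, Set.mem_univ, true_imp_iff]
    constructor
    · intro hz
      refine ⟨fun e => z (σ e), fun e => ?_, by simp⟩
      by_cases he : cycleMatrix hT e = 0
      · simp [he]
      · rw [← hdot ⟨e, he⟩]
        simpa using hz ⟨e, he⟩
    · rintro ⟨z, hz, rfl⟩ e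
      rw [hdot]
      exact hz e
  have hcube : ∀ k : ℕ, {z : Fin r → ℤ | ∀ e ∈ Set.range c, |A e ⬝ᵥ z| ≤ k}.ncard =
      (2 * k + 1) ^ r := by
    intro k
    have := ncard_cube (ι := Fin r) k
    rw [Fintype.card_fin] at this
    rw [← this]
    congr 1
    ext z
    simp [hc]
  obtain ⟨L, hLd, hL⟩ := exists_polynomial (r := r) (h := h)
    (fun i hi => Nat.eq_zero_of_le_zero (by rw [← (hb i).2.2 hi]; exact (hb i).2.1))
    (by have := (hb 0).1; rw [Nat.choose_zero_right] at this; omega)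
  refine ⟨L, fun k hk => ?_, hLd, fun i => ?_⟩
  · rw [hL, coeff_of_hasSeries_slabCone hs, hcount, ehrhart_flowPolytope hT hk]
  · have hLQ : ∀ k : ℕ, ((2 * X + 1 : ℚ[X]) ^ r).eval (k : ℚ) =
        (PowerSeries.coeff k (hQ * PowerSeries.mk 1 ^ (r + 1)) : ℕ) := fun k => by
      rw [coeff_of_hasSeries_slabCone hsQ, hcube]; simp
    rw [hStar_eq_coeff hLd hL, hStar_eq_coeff (natDegree_two_mul_X_add_one_pow r) hLQ]
    exact ⟨by exact_mod_cast (hb i).1, by exact_mod_cast (hb i).2.1⟩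

theorem isSpanningForest_bouquet (r : ℕ) : (bouquet r).IsSpanningForest ∅ := by
  refine ⟨?_, fun T hT _ e he => ?_⟩
  · rintro u l ⟨hl, -, hmem, -⟩
    obtain ⟨s, l', rfl⟩ := List.exists_cons_of_ne_nil hl
    simpa using hmem s List.mem_cons_self
  · -- every loop is a cycle
    exact absurd ⟨by simp, ⟨rfl, rfl⟩, by simpa using he, by simp, by simp⟩ (hT () [(e, true)])

theorem isEhrhartPolynomial_bouquet (r : ℕ) :
    IsEhrhartPolynomial ((2 * X + 1) ^ r) ((bouquet r).flowPolytope ∅) := by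
  intro k hk
  have : ehrhart ((bouquet r).flowPolytope ∅) k =
      {z : {e : Fin r // e ∉ (∅ : Finset (Fin r))} → ℤ | ∀ e, |z e| ≤ k}.ncard := by
    rw [ehrhart]
    congr 1
    ext z
    rw [Set.mem_ofPred_eq, Set.mem_ofPred_eq, mem_smul_flowPolytope _ _ hk]
    constructor
    · rintro ⟨-, h⟩ e
      exact_mod_cast h e
    · intro h
      exact ⟨fun t => absurd t.2 (Finset.notMem_empty _), fun e => by exact_mod_cast h e⟩
  rw [this, ncard_cube]
  simp

end DirMultigraph

theorem theorem7p9 (r : ℕ) :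
    (∀ (V : Type u) (E : Type v) [Fintype V] [Fintype E] [DecidableEq E]
        (G : DirMultigraph V E) (T : Finset E),
        G.Connected →
        (r : ℤ) = (Fintype.card E : ℤ) - (Fintype.card V : ℤ) + 1 →
        G.IsSpanningForest T →
        ∃ L : ℚ[X], IsEhrhartPolynomial L (G.flowPolytope T) ∧ L.natDegree = r ∧
          ∀ i : ℕ, (r.choose i : ℚ) ≤ hStar L i ∧ hStar L i ≤ hStar ((2 * X + 1) ^ r) i) ∧
    (∀ i : ℕ, hStar ((2 * X + 1) ^ r) i = (macMahon (r + 1) (i + 1) : ℚ)) ∧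
    ((DirMultigraph.bouquet r).Connected ∧
      (r : ℤ) = (Fintype.card (Fin r) : ℤ) - (Fintype.card Unit : ℤ) + 1 ∧
      (DirMultigraph.bouquet r).IsSpanningForest ∅ ∧
      ∃ L : ℚ[X], IsEhrhartPolynomial L ((DirMultigraph.bouquet r).flowPolytope ∅) ∧
        L.natDegree = r ∧ ∀ i : ℕ, hStar L i = (macMahon (r + 1) (i + 1) : ℚ)) := by
  refine ⟨fun V E _ _ _ G T hG hr hT => ?_, LatticeCone.hStar_cube r, ?_, by simp,
    DirMultigraph.isSpanningForest_bouquet r, (2 * X + 1) ^ r,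
    DirMultigraph.isEhrhartPolynomial_bouquet r, LatticeCone.natDegree_two_mul_X_add_one_pow r,
    LatticeCone.hStar_cube r⟩
  · refine DirMultigraph.exists_ehrhart_bounds hT ?_
    have := DirMultigraph.card_compl_forest hT hG
    omega
  · exact ⟨⟨()⟩, fun _ _ => ⟨[], rfl⟩⟩
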